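/- Let $\nu:[-\pi,\pi]\to\mathbb{C}$ be a smooth function such that $\delta:=\nu(\pi)-\nu(-\pi)$ is a nonnegative real number (for instance a nonnegative integer, the winding number of $\nu$). For $L\ge 1$ put $q_j=\frac{2\pi}{L}\left(-\frac{L+1}{2}+j\right)$ and $\nu_j=\nu(q_j)$, $j=1,\dots,L$. Let $G$ be the Barnes $G$-function (so $G(1)=1$, $G(x+1)=\Gamma(x)G(x)$), let $$F(\pi)=\int_{-\pi}^{\pi}\left(\frac{\nu(-\pi)}{\pi+q}+\frac{\nu(\pi)}{q-\pi}-\frac{\nu(q)}{2}\cot\frac{q-\pi}{2}\right)dq ,$$ which is the value at $q_a=\pi$ of $$F(q_a)=\int_{q_a}^{\pi}\left(-\frac{\nu(\pi)}{2\pi+q_a-q}+\frac{\nu(q_a)}{q-q_a}-\frac{\nu(q)}{2}\cot\frac{q-q_a}{2}\right)dq+\int_{-\pi}^{q_a}\left(\frac{\nu(-\pi)}{2\pi+q-q_a}+\frac{\nu(q_a)}{q-q_a}-\frac{\nu(q)}{2}\cot\frac{q-q_a}{2}\right)dq ,$$ and let $$\mathcal{A}=G(1+\delta)\,(2\pi)^{-\frac{\delta(\delta+1)}{2}}\exp\left(\frac{\delta}{2}-\delta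 F(\pi)-\int_{-\pi}^{\pi}dq\int_{-\pi}^{\pi}dk\left[\frac{\nu(q)-\nu(k)-\delta(q-k)/(2\pi)}{4\sin\frac{q-k}{2}}\right]^2\right).$$ Then the integral $F(\pi)$ and the double integral converge absolutely, $\mathcal{A}\neq 0$, and as $L\to\infty$ $$\prod_{i=1}^{L}\prod_{j=1}^{i-1}\frac{\sin\frac{\pi}{L}(i-j-\nu_i+\nu_j)}{\sin\frac{\pi(i-j)}{L}}\;\sim\;\frac{\mathcal{A}}{L^{\delta^2/2}},$$ i.e. the ratio of the two sides tends to $1$. -/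

import Mathlib

open scoped ContDiff

/-- The Barnes `G`-function on the real line, through its Weierstrass product
`G(1 + z) = (2π)^{z/2} exp(-(z + z²(1 + γ))/2) ∏_{k ≥ 1} (1 + z/k)^k exp(z²/(2k) - z)`,
here with `z = x - 1`. -/
noncomputable def barnesG (x : ℝ) : ℝ :=
  (2 * Real.pi) ^ ((x - 1) / 2) *
    Real.exp (-((x - 1) + (x - 1) ^ 2 * (1 + Real.eulerMascheroniConstant)) / 2) *
    ∏' k : ℕ, (1 + (x - 1) / ((k : ℝ) + 1)) ^ (k + 1) *
      Real.exp ((x - 1) ^ 2 / (2 * ((k : ℝ) + 1)) - (x - 1))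

/-- The lattice momenta `q_j = (2π/L) (-(L+1)/2 + j)`. -/
noncomputable def momentum (L j : ℕ) : ℝ :=
  2 * Real.pi / (L : ℝ) * (-((L : ℝ) + 1) / 2 + (j : ℝ))

/-- The double product
`∏_{i=1}^{L} ∏_{j=1}^{i-1} sin(π (i - j - ν_i + ν_j) / L) / sin(π (i - j) / L)`, `ν_j = ν(q_j)`. -/
noncomputable def doubleProduct (ν : ℝ → ℂ) (L : ℕ) : ℂ :=
  ∏ i ∈ Finset.Icc 1 L, ∏ j ∈ Finset.Ico 1 i,
    Complex.sin ((Real.pi : ℂ) / (L : ℂ) *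
        ((i : ℂ) - (j : ℂ) - ν (momentum L i) + ν (momentum L j))) /
      Complex.sin ((Real.pi : ℂ) * ((i : ℂ) - (j : ℂ)) / (L : ℂ))

/-- The integrand of `F(a)` on `[a, π]`. -/
noncomputable def integrandRight (ν : ℝ → ℂ) (a q : ℝ) : ℂ :=
  -(ν Real.pi / ((2 * Real.pi + a - q : ℝ) : ℂ)) + ν a / ((q - a : ℝ) : ℂ)
    - ν q / 2 * ((Real.cot ((q - a) / 2) : ℝ) : ℂ)

/-- The integrand of `F(a)` on `[-π, a]`. -/
noncomputable def integrandLeft (ν : ℝ → ℂ) (a q : ℝ) : ℂ :=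
  ν (-Real.pi) / ((2 * Real.pi + q - a : ℝ) : ℂ) + ν a / ((q - a : ℝ) : ℂ)
    - ν q / 2 * ((Real.cot ((q - a) / 2) : ℝ) : ℂ)

/-- The function `F(a)`, for `a ∈ [-π, π]`. -/
noncomputable def phaseF (ν : ℝ → ℂ) (a : ℝ) : ℂ :=
  (∫ q in a..Real.pi, integrandRight ν a q) + ∫ q in (-Real.pi)..a, integrandLeft ν a q

/-- The kernel `[(ν(q) - ν(k) - δ (q - k)/(2π)) / (4 sin((q - k)/2))]²`. -/
noncomputable def windingKernel (ν : ℝ → ℂ) (δ q k : ℝ) : ℂ :=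
  ((ν q - ν k - (δ : ℂ) * ((q - k : ℝ) : ℂ) / (2 * (Real.pi : ℂ))) /
    (4 * ((Real.sin ((q - k) / 2) : ℝ) : ℂ))) ^ 2

/-- The prefactor `𝒜 = G(1+δ) (2π)^{-δ(δ+1)/2} exp(δ/2 - δ F(π) - ∫∫ kernel)`. -/
noncomputable def prefactor (ν : ℝ → ℂ) (δ : ℝ) : ℂ :=
  ((barnesG (1 + δ) : ℝ) : ℂ) * (((2 * Real.pi) ^ (-(δ * (δ + 1) / 2)) : ℝ) : ℂ) *
    Complex.exp ((δ : ℂ) / 2 - (δ : ℂ) * phaseF ν Real.pi -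
      ∫ q in (-Real.pi)..Real.pi, ∫ k in (-Real.pi)..Real.pi, windingKernel ν δ q k)

/-!
The factor of the pair `j < i` is `sin (x + h D) / sin x` with mesh `h = π / L`, angle
`x = π - π (i - j) / L` and increment `D = ν_i - ν_j`. Only the Lipschitz continuity of `ν` matters:
it gives `D = O(π - x)` and, because `ν(π) - ν(-π) = δ`, also `D - δ = O(x)`.

Away from the corner `x → 0` the logarithm of a factor is `h D cot x - h² D² / (2 sin² x) + ⋯`. The
first order terms sum to zero exactly, because the cotangent is odd and `π`-periodic
(`sum_increment_mul_cot`). Near the corner the expansion fails, and the factor is compared with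
`1 + h δ / x = 1 + δ / m`, where `m = L - (i - j)`; there are `m` pairs for each `m`. Hence
(`doubleProduct_eq`) the double product is `∏ ((1 + δ / m) exp (-δ / m)) ^ m` times the exponential
of the sum of remainders `logRemainder`.

* The first product is a Weierstrass product without its convergence factors `exp (δ² / 2m)`. It
  gives `G(1 + δ)` and, through the harmonic sum, the power `L ^ (-δ² / 2)`
  (`tendsto_prod_mul_rpow`).
* The remainders are `O(h² / x)` (`exists_norm_logRemainder_le`), which is integrable at the corner in
  two dimensions. So their sum converges, as a Riemann sum, to the integral over `k < q` of
  `-D² / (8 sin² (t / 2)) + δ² / (2 (2π - t)²)`, where `t = q - k`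
  (`integrable_remainderDensity_and_tendsto`).
* Splitting off the winding kernel leaves a density of degree one in `D`. It is integrated over `k`
  at fixed `t`, symmetrized under `t ↦ 2π - t`, and compared with the symmetrized integrand of
  `F(π)`: the sum has an explicit primitive up to a multiple of `log (sin (t / 2))`, whose integral
  is known (`hasDerivAt_distancePrimitive`, `integral_distanceDensity`).
-/

open Filter Topology MeasureTheory Real

/-! ### Expansion of a single factor -/

theorem inv_sin_le {x : ℝ} (h0 : 0 < x) (hπ : x < π) :
    1 / sin x ≤ π / 2 * (1 / x + 1 / (π - x)) := by
  have hs : 0 < sin x := sin_pos_of_pos_of_lt_pi h0 hπ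
  have hy : 0 < π - x := by linarith
  have key : ∀ y, 0 < y → y ≤ π / 2 → 1 / sin y ≤ π / 2 * (1 / y) := by
    intro y hy0 hy1
    have h := Real.mul_le_sin hy0.le hy1
    have h2 : 0 < 2 / π * y := by positivity
    calc 1 / sin y ≤ 1 / (2 / π * y) := one_div_le_one_div_of_le h2 h
      _ = π / 2 * (1 / y) := by field_simp
  have hp := pi_pos
  rcases le_total x (π / 2) with h | h
  · refine (key x h0 h).trans ?_
    have : 0 < 1 / (π - x) := by positivity
    gcongr; linarith
  · have := key (π - x) hy (by linarith)
    rw [sin_pi_sub] at this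
    refine this.trans ?_
    have : 0 < 1 / x := by positivity
    gcongr; linarith

/-- The cotangent is `1/x` up to a bounded error on any interval `(0, a]` with `a < π`; the weight
`π - x` makes the bound uniform up to the other pole. -/
theorem abs_cot_sub_inv_mul_le {x : ℝ} (h0 : 0 < x) (hπ : x < π) :
    |cot x - 1 / x| * (π - x) ≤ 5 := by
  have hs : 0 < sin x := sin_pos_of_pos_of_lt_pi h0 hπ
  have hy : 0 < π - x := by linarith
  have hle : x * cos x ≤ sin x := by
    rcases lt_or_ge x (π / 2) with h | h
    · have := Real.lt_tan h0 h
      have hc : 0 < cos x := cos_pos_of_mem_Ioo ⟨by linarith, h⟩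
      rw [tan_eq_sin_div_cos, lt_div_iff₀ hc] at this
      exact this.le
    · have : cos x ≤ 0 := cos_nonpos_of_pi_div_two_le_of_le h (by linarith)
      nlinarith
  have e : cot x - 1 / x = -((sin x - x * cos x) / (x * sin x)) := by
    rw [cot_eq_cos_div_sin]; field_simp; ring
  rw [e, abs_neg, abs_of_nonneg (div_nonneg (by linarith) (by positivity)), div_mul_eq_mul_div,
    div_le_iff₀ (by positivity)]
  have hp := pi_gt_three
  have hp' := pi_lt_d2
  rcases le_total x (π / 2) with h | h
  · have h1 := Real.mul_le_sin h0.le h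
    have h2 : sin x - x * cos x ≤ x ^ 3 / 2 := by
      have := Real.one_sub_sq_div_two_le_cos (x := x)
      have := Real.sin_le h0.le
      nlinarith
    have h3 : 2 / π * x ≥ 3 / 5 * x := by
      have : 3 / 5 ≤ 2 / π := by rw [le_div_iff₀ pi_pos]; linarith
      gcongr
    calc (sin x - x * cos x) * (π - x) ≤ x ^ 3 / 2 * π := by
          gcongr; linarith
      _ ≤ x ^ 2 * 3 := by nlinarith [sq_nonneg x]
      _ ≤ 5 * (x * sin x) := by nlinarith
  · have h1 := Real.mul_le_sin hy.le (by linarith)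
    rw [sin_pi_sub] at h1
    have h3 : 2 / π * (π - x) ≥ 3 / 5 * (π - x) := by
      have : 3 / 5 ≤ 2 / π := by rw [le_div_iff₀ pi_pos]; linarith
      gcongr
    have h2 : sin x - x * cos x ≤ 1 + x := by
      have := Real.neg_one_le_cos x
      have := Real.sin_le_one x
      nlinarith
    calc (sin x - x * cos x) * (π - x) ≤ (1 + x) * (π - x) := by gcongr
      _ ≤ 3 * x * (π - x) := by gcongr; nlinarith
      _ ≤ 5 * (x * sin x) := by nlinarith

/-- The part of the logarithm of a reduced factor that is of first order in the mesh `h`. -/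
noncomputable def firstOrder (δ h x : ℝ) (D : ℂ) : ℂ :=
  h * (D * ((cot x : ℝ) : ℂ) - δ / x)

/-- A factor `sin (x + h D) / sin x` of the double product, divided by its singular part
`1 + h δ / x` at the corner `x → 0`. -/
noncomputable def reducedFactor (δ h x : ℝ) (D : ℂ) : ℂ :=
  Complex.sin (x + h * D) / Complex.sin x / (1 + h * δ / x)

/-- The part of the logarithm of a reduced factor that is of second order in the mesh `h`. -/
noncomputable def logRemainder (δ h x : ℝ) (D : ℂ) : ℂ :=
  Complex.log (reducedFactor δ h x D) - firstOrder δ h x D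

/-- The error of the expansion of `sin (x + e) / sin x` as `1 + e cot x`. -/
noncomputable def sineError (x : ℝ) (e : ℂ) : ℂ :=
  Complex.cos e - 1 + (Complex.sin e - e) * ((cot x : ℝ) : ℂ)

/-- The expansion `sin (x + e) / sin x = 1 + e cot x + sineError x e` divided by `1 + h δ / x`. -/
theorem reducedFactor_eq {δ h x : ℝ} (D : ℂ) (hs : sin x ≠ 0) (hx : 0 < x) (hh : 0 < h)
    (hδ : 0 ≤ δ) :
    reducedFactor δ h x D =
      1 + (firstOrder δ h x D + sineError x (h * D)) / (1 + h * δ / x) := by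
  have h1 : (1 + h * δ / x : ℂ) ≠ 0 := by
    have : (0 : ℝ) < 1 + h * δ / x := by positivity
    exact_mod_cast this.ne'
  have hs' : Complex.sin x ≠ 0 := by rw [← Complex.ofReal_sin]; exact_mod_cast hs
  rw [reducedFactor, div_eq_iff h1, add_mul, div_mul_cancel₀ _ h1, Complex.sin_add, firstOrder,
    sineError, cot_eq_cos_div_sin]
  push_cast
  field_simp
  ring

theorem norm_cos_sub_one_le {e : ℂ} (he : ‖e‖ ≤ 1) : ‖Complex.cos e - 1‖ ≤ ‖e‖ ^ 2 := by
  have h := Complex.cos_bound he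
  have : Complex.cos e - 1 = (Complex.cos e - (1 - e ^ 2 / 2)) - e ^ 2 / 2 := by ring
  rw [this]
  refine (norm_sub_le _ _).trans ?_
  have h2 : ‖e ^ 2 / 2‖ = ‖e‖ ^ 2 / 2 := by simp
  have h4 : ‖e‖ ^ 4 ≤ ‖e‖ ^ 2 := pow_le_pow_of_le_one (norm_nonneg _) he (by norm_num)
  rw [h2]; nlinarith [sq_nonneg ‖e‖]

theorem norm_sin_sub_self_le {e : ℂ} (he : ‖e‖ ≤ 1) : ‖Complex.sin e - e‖ ≤ ‖e‖ ^ 3 := by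
  have h := Complex.sin_bound he
  have : Complex.sin e - e = (Complex.sin e - (e - e ^ 3 / 6)) - e ^ 3 / 6 := by ring
  rw [this]
  refine (norm_sub_le _ _).trans ?_
  have h2 : ‖e ^ 3 / 6‖ = ‖e‖ ^ 3 / 6 := by simp
  have h4 : ‖e‖ ^ 5 ≤ ‖e‖ ^ 3 := pow_le_pow_of_le_one (norm_nonneg _) he (by norm_num)
  rw [h2]; nlinarith [pow_nonneg (norm_nonneg e) 3]

theorem abs_cot_le {x : ℝ} (h0 : 0 < x) (hπ : x < π) : |cot x| ≤ 1 / sin x := by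
  have hs : 0 < sin x := sin_pos_of_pos_of_lt_pi h0 hπ
  rw [cot_eq_cos_div_sin, abs_div, abs_of_pos hs]
  gcongr
  exact abs_cos_le_one x

section bounds
variable {K δ h x : ℝ} {D : ℂ}

theorem norm_firstOrder_le (h0 : 0 < x) (hπ : x < π) (hh : 0 < h)
    (hD : ‖D‖ ≤ 2 * K * (π - x)) (hDδ : ‖D - δ‖ ≤ 2 * K * x) :
    ‖firstOrder δ h x D‖ ≤ 12 * K * h := by
  have hx : (x : ℂ) ≠ 0 := by exact_mod_cast h0.ne'
  have hK : 0 ≤ K := by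
    have := (norm_nonneg _).trans hDδ
    by_contra! hc
    nlinarith
  have e : firstOrder δ h x D = h * ((D - δ) / x + D * ((cot x - 1 / x : ℝ) : ℂ)) := by
    rw [firstOrder]; push_cast; field_simp; ring
  rw [e, norm_mul, Complex.norm_real, norm_of_nonneg hh.le]
  have h1 : ‖(D - δ) / x‖ ≤ 2 * K := by
    rw [norm_div, Complex.norm_real, norm_of_nonneg h0.le, div_le_iff₀ h0]; exact hDδ
  have h2 : ‖D * ((cot x - 1 / x : ℝ) : ℂ)‖ ≤ 10 * K := by
    rw [norm_mul, Complex.norm_real, norm_eq_abs]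
    calc ‖D‖ * |cot x - 1 / x| ≤ 2 * K * (π - x) * |cot x - 1 / x| := by gcongr
      _ = 2 * K * (|cot x - 1 / x| * (π - x)) := by ring
      _ ≤ 2 * K * 5 := by gcongr; exact abs_cot_sub_inv_mul_le h0 hπ
      _ = 10 * K := by ring
  calc h * ‖(D - δ) / x + D * ((cot x - 1 / x : ℝ) : ℂ)‖ ≤ h * (2 * K + 10 * K) := by
        gcongr; exact norm_add_le_of_le h1 h2
    _ = 12 * K * h := by ring

theorem norm_sineError_le (hK : 0 ≤ K) (hxh : h ≤ x) (hπ : x < π) (hh : 0 < h)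
    (hh1 : 7 * K * h ≤ 1) (hD : ‖D‖ ≤ 2 * K * (π - x)) :
    ‖sineError x (h * D)‖ ≤ 49 * K ^ 2 * (1 + 10 * K) * h ^ 2 := by
  have h0 : 0 < x := hh.trans_le hxh
  have hs : 0 < sin x := sin_pos_of_pos_of_lt_pi h0 hπ
  have hp := pi_lt_d2
  have hp3 := pi_gt_three
  have hD7 : ‖D‖ ≤ 7 * K := hD.trans (by nlinarith)
  have en : ‖(h * D : ℂ)‖ = h * ‖D‖ := by
    rw [norm_mul, Complex.norm_real, norm_of_nonneg hh.le]
  have he : ‖(h * D : ℂ)‖ ≤ 7 * K * h := by rw [en]; nlinarith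
  have he1 := he.trans hh1
  -- `h ≤ x` keeps `e / sin x` bounded near `x = 0`, and the decay of `D` does so near `x = π`.
  have hes : ‖(h * D : ℂ)‖ * (1 / sin x) ≤ 10 * K := by
    have hy : 0 < π - x := by linarith
    calc ‖(h * D : ℂ)‖ * (1 / sin x)
        ≤ (h * (2 * K * (π - x))) * (π / 2 * (1 / x + 1 / (π - x))) := by
          rw [en]; gcongr; exact inv_sin_le h0 hπ
      _ = π ^ 2 * K * (h / x) := by field_simp; ring
      _ ≤ 10 * K * 1 := by
          have : h / x ≤ 1 := by rw [div_le_one h0]; exact hxh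
          gcongr; nlinarith
      _ = 10 * K := by ring
  have hc := norm_cos_sub_one_le he1
  have hsn := norm_sin_sub_self_le he1
  have hcot := abs_cot_le h0 hπ
  set e : ℂ := h * D
  calc ‖sineError x e‖ ≤ ‖e‖ ^ 2 + ‖e‖ ^ 3 * (1 / sin x) := by
        refine norm_add_le_of_le hc ?_
        rw [norm_mul, Complex.norm_real, norm_eq_abs]
        gcongr
    _ = ‖e‖ ^ 2 * (1 + ‖e‖ * (1 / sin x)) := by ring
    _ ≤ (7 * K * h) ^ 2 * (1 + 10 * K) := by gcongr
    _ = 49 * K ^ 2 * (1 + 10 * K) * h ^ 2 := by ring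

/-- The second order remainder is `O(h² / x)` uniformly up to the corner `x = h`, provided the
increment `D` vanishes linearly at `x = π` and approaches `δ` linearly at `x = 0`. -/
theorem exists_norm_logRemainder_le (hK : 0 ≤ K) (hδ : 0 ≤ δ) :
    ∃ C h₀ : ℝ, 0 ≤ C ∧ 0 < h₀ ∧ ∀ (h x : ℝ) (D : ℂ), 0 < h → h ≤ h₀ → h ≤ x → x < π →
      ‖D‖ ≤ 2 * K * (π - x) → ‖D - δ‖ ≤ 2 * K * x →
      reducedFactor δ h x D ≠ 0 ∧ ‖logRemainder δ h x D‖ ≤ C * (h ^ 2 / x) := by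
  set C₂ : ℝ := 49 * K ^ 2 * (1 + 10 * K)
  have hC₂ : 0 ≤ C₂ := by positivity
  set C₁ : ℝ := 12 * K + C₂
  have hC₁ : 0 ≤ C₁ := by positivity
  refine ⟨4 * (C₁ ^ 2 + C₂) + 12 * K * δ, 1 / (7 * K + 2 * C₁ + 1), by positivity, by positivity,
    ?_⟩
  intro h x D hh hh0 hxh hπ hD hDδ
  have h0 : 0 < x := hh.trans_le hxh
  have hs : 0 < sin x := sin_pos_of_pos_of_lt_pi h0 hπ
  rw [le_div_iff₀ (by positivity)] at hh0
  have hKh : 0 ≤ K * h := by positivity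
  have hCh : 0 ≤ C₁ * h := by positivity
  have hh1 : h ≤ 1 := by nlinarith
  have hz := norm_firstOrder_le h0 hπ hh hD hDδ
  have hw := norm_sineError_le hK hxh hπ hh (by nlinarith) hD
  have hreal : (1 : ℝ) ≤ 1 + h * δ / x := by
    have : 0 ≤ h * δ / x := by positivity
    linarith
  have hne : (1 + h * δ / x : ℂ) ≠ 0 := by
    have : (0 : ℝ) < 1 + h * δ / x := by positivity
    exact_mod_cast this.ne'
  have hnorm : 1 ≤ ‖(1 + h * δ / x : ℂ)‖ := by
    have : (1 + h * δ / x : ℂ) = ((1 + h * δ / x : ℝ) : ℂ) := by push_cast; ring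
    rw [this, Complex.norm_real, norm_of_nonneg (by linarith)]; exact hreal
  have hdiv : ∀ a : ℂ, ‖a / (1 + h * δ / x : ℂ)‖ ≤ ‖a‖ := fun a => by
    rw [norm_div]; exact div_le_self (norm_nonneg _) hnorm
  rw [logRemainder, reducedFactor_eq D hs.ne' h0 hh hδ]
  set z := firstOrder δ h x D
  set w := sineError x (h * D)
  set u : ℂ := (z + w) / (1 + h * δ / x) with hu_def
  have hu : ‖u‖ ≤ C₁ * h := by
    refine (hdiv _).trans ((norm_add_le_of_le hz hw).trans ?_)
    have : C₂ * h ^ 2 ≤ C₂ * h := by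
      gcongr; nlinarith
    calc 12 * K * h + C₂ * h ^ 2 ≤ 12 * K * h + C₂ * h := by gcongr
      _ = C₁ * h := by ring
  have hu2 : ‖u‖ ≤ 1 / 2 := hu.trans (by nlinarith)
  -- The difference `u - z` is of second order, but only up to the factor `1 / x`.
  have huz : u - z = (w - z * (h * δ / x)) / (1 + h * δ / x) := by
    rw [hu_def]; field_simp; ring
  have huz' : ‖u - z‖ ≤ C₂ * h ^ 2 + 12 * K * δ * (h ^ 2 / x) := by
    rw [huz]
    refine (hdiv _).trans (norm_sub_le_of_le hw ?_)
    have e : (h * δ / x : ℂ) = ((h * δ / x : ℝ) : ℂ) := by push_cast; ring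
    rw [norm_mul, e, Complex.norm_real, norm_of_nonneg (by positivity)]
    calc ‖z‖ * (h * δ / x) ≤ 12 * K * h * (h * δ / x) := by gcongr
      _ = 12 * K * δ * (h ^ 2 / x) := by ring
  constructor
  · intro hzero
    have : u = -1 := by linear_combination hzero
    rw [this] at hu2; norm_num at hu2
  · have hlog : ‖Complex.log (1 + u) - u‖ ≤ ‖u‖ ^ 2 := by
      refine (Complex.norm_log_one_add_sub_self_le (by linarith)).trans ?_
      have : (1 - ‖u‖)⁻¹ ≤ 2 := by
        rw [inv_le_comm₀ (by linarith) (by norm_num)]; linarith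
      nlinarith [sq_nonneg ‖u‖]
    have hx4 : h ^ 2 ≤ 4 * (h ^ 2 / x) := by
      rw [← mul_div_assoc, le_div_iff₀ h0]
      have := pi_lt_d2
      nlinarith [sq_nonneg h]
    calc ‖Complex.log (1 + u) - z‖ = ‖(Complex.log (1 + u) - u) + (u - z)‖ := by congr 1; ring
      _ ≤ (C₁ * h) ^ 2 + (C₂ * h ^ 2 + 12 * K * δ * (h ^ 2 / x)) := by
          refine norm_add_le_of_le (hlog.trans ?_) huz'
          gcongr
      _ = (C₁ ^ 2 + C₂) * h ^ 2 + 12 * K * δ * (h ^ 2 / x) := by ring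
      _ ≤ (C₁ ^ 2 + C₂) * (4 * (h ^ 2 / x)) + 12 * K * δ * (h ^ 2 / x) := by gcongr
      _ = (4 * (C₁ ^ 2 + C₂) + 12 * K * δ) * (h ^ 2 / x) := by ring

end bounds

theorem tendsto_sineError {ι : Type*} {l : Filter ι} {h x : ι → ℝ} {D : ι → ℂ} {x₀ : ℝ} {D₀ : ℂ}
    (hx₀ : 0 < x₀) (hxπ : x₀ < π) (hpos : ∀ i, 0 < h i)
    (hh : Tendsto h l (𝓝 0)) (hx : Tendsto x l (𝓝 x₀)) (hD : Tendsto D l (𝓝 D₀)) :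
    Tendsto (fun i => sineError (x i) (h i * D i) / (h i : ℂ) ^ 2) l (𝓝 (-(D₀ ^ 2 / 2))) := by
  have hhC : Tendsto (fun i => (h i : ℂ)) l (𝓝 0) := by simpa using hh.ofReal
  have he : Tendsto (fun i => (h i : ℂ) * D i) l (𝓝 0) := by simpa using hhC.mul hD
  have he1 : ∀ᶠ i in l, ‖(h i : ℂ) * D i‖ ≤ 1 := by
    have := he.norm
    rw [norm_zero] at this
    filter_upwards [this.eventually (gt_mem_nhds one_pos)] with i hi using hi.le
  have hs : sin x₀ ≠ 0 := (sin_pos_of_pos_of_lt_pi hx₀ hxπ).ne'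
  have hcot : Tendsto (fun i => cot (x i)) l (𝓝 (cot x₀)) := by
    simp only [cot_eq_cos_div_sin]
    exact ((continuous_cos.tendsto _).comp hx).div ((continuous_sin.tendsto _).comp hx) hs
  have hcotC : Tendsto (fun i => ((cot (x i) : ℝ) : ℂ)) l (𝓝 ((cot x₀ : ℝ) : ℂ)) :=
    (Complex.continuous_ofReal.tendsto _).comp hcot
  have hne : ∀ i, (h i : ℂ) ≠ 0 := fun i => by exact_mod_cast (hpos i).ne'
  have h1 : Tendsto (fun i => (Complex.cos (h i * D i) - (1 - (h i * D i) ^ 2 / 2)) /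
      (h i : ℂ) ^ 2) l (𝓝 0) := by
    have hb : Tendsto (fun i => ‖D i‖ ^ 4 * h i ^ 2) l (𝓝 0) := by
      simpa using (hD.norm.pow 4).mul (hh.pow 2)
    refine squeeze_zero_norm' ?_ hb
    filter_upwards [he1] with i hi
    have h2 := Complex.cos_bound hi
    rw [norm_mul, Complex.norm_real, norm_of_nonneg (hpos i).le] at h2
    rw [norm_div, norm_pow, Complex.norm_real, norm_of_nonneg (hpos i).le,
      div_le_iff₀ (by have := hpos i; positivity)]
    have : 0 ≤ (h i * ‖D i‖) ^ 4 := by have := hpos i; positivity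
    calc _ ≤ _ := h2
      _ ≤ (h i * ‖D i‖) ^ 4 := by nlinarith
      _ = _ := by ring
  have h2 : Tendsto (fun i => (Complex.sin (h i * D i) - h i * D i) / (h i : ℂ) ^ 2) l (𝓝 0) := by
    have hb : Tendsto (fun i => ‖D i‖ ^ 3 * h i) l (𝓝 0) := by
      simpa using (hD.norm.pow 3).mul hh
    refine squeeze_zero_norm' ?_ hb
    filter_upwards [he1] with i hi
    have h2 := norm_sin_sub_self_le hi
    rw [norm_mul, Complex.norm_real, norm_of_nonneg (hpos i).le] at h2
    rw [norm_div, norm_pow, Complex.norm_real, norm_of_nonneg (hpos i).le,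
      div_le_iff₀ (by have := hpos i; positivity)]
    calc _ ≤ _ := h2
      _ = _ := by ring
  have h3 := (h1.sub ((hD.pow 2).div_const 2)).add (h2.mul hcotC)
  simp only [zero_sub, zero_mul, add_zero] at h3
  refine h3.congr fun i => ?_
  have := hne i
  rw [sineError]
  field_simp
  ring

/-- Pointwise limit of the second order remainders, as the mesh `h` tends to zero. -/
theorem tendsto_logRemainder {ι : Type*} {l : Filter ι} {h x : ι → ℝ} {D : ι → ℂ} {x₀ δ : ℝ}
    {D₀ : ℂ} (hδ : 0 ≤ δ) (hx₀ : 0 < x₀) (hxπ : x₀ < π) (hpos : ∀ i, 0 < h i)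
    (hh : Tendsto h l (𝓝 0)) (hx : Tendsto x l (𝓝 x₀)) (hD : Tendsto D l (𝓝 D₀)) :
    Tendsto (fun i => logRemainder δ (h i) (x i) (D i) / (h i : ℂ) ^ 2) l
      (𝓝 (-(1 / 2) * (D₀ ^ 2 / Complex.sin x₀ ^ 2 - δ ^ 2 / (x₀ : ℂ) ^ 2))) := by
  have hw := tendsto_sineError hx₀ hxπ hpos hh hx hD
  have hhC : Tendsto (fun i => (h i : ℂ)) l (𝓝 0) := by simpa using hh.ofReal
  have hxC : Tendsto (fun i => (x i : ℂ)) l (𝓝 x₀) := (Complex.continuous_ofReal.tendsto _).comp hx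
  have hx₀C : (x₀ : ℂ) ≠ 0 := by exact_mod_cast hx₀.ne'
  have hs : sin x₀ ≠ 0 := (sin_pos_of_pos_of_lt_pi hx₀ hxπ).ne'
  have hcot : Tendsto (fun i => cot (x i)) l (𝓝 (cot x₀)) := by
    simp only [cot_eq_cos_div_sin]
    exact ((continuous_cos.tendsto _).comp hx).div ((continuous_sin.tendsto _).comp hx) hs
  have hcotC : Tendsto (fun i => ((cot (x i) : ℝ) : ℂ)) l (𝓝 ((cot x₀ : ℝ) : ℂ)) :=
    (Complex.continuous_ofReal.tendsto _).comp hcot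
  have hne : ∀ i, (h i : ℂ) ≠ 0 := fun i => by exact_mod_cast (hpos i).ne'
  set Z : ℂ := D₀ * ((cot x₀ : ℝ) : ℂ) - δ / x₀ with hZ
  have hδx : Tendsto (fun i => (δ : ℂ) / x i) l (𝓝 (δ / x₀)) := tendsto_const_nhds.div hxC hx₀C
  have hz : Tendsto (fun i => firstOrder δ (h i) (x i) (D i) / h i) l (𝓝 Z) := by
    refine ((hD.mul hcotC).sub hδx).congr fun i => ?_
    rw [firstOrder, mul_div_cancel_left₀ _ (hne i)]
  have hden : Tendsto (fun i => (1 + h i * δ / x i : ℂ)) l (𝓝 1) := by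
    have := (hhC.mul hδx).const_add 1
    simp only [zero_mul, add_zero] at this
    refine this.congr fun i => by ring
  have hxpos : ∀ᶠ i in l, 0 < x i := hx.eventually (lt_mem_nhds hx₀)
  have hsin : ∀ᶠ i in l, sin (x i) ≠ 0 :=
    ((continuous_sin.tendsto _).comp hx).eventually_ne hs
  set u : ι → ℂ := fun i => (firstOrder δ (h i) (x i) (D i) + sineError (x i) (h i * D i)) /
    (1 + h i * δ / x i) with hu
  have huh : Tendsto (fun i => u i / h i) l (𝓝 Z) := by
    have := (hz.add (hw.mul hhC)).div hden one_ne_zero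
    simp only [mul_zero, add_zero, div_one] at this
    refine this.congr fun i => ?_
    have := hne i
    simp only [Pi.div_apply, hu]
    field_simp
  have hu0 : Tendsto u l (𝓝 0) := by
    have := huh.mul hhC
    rw [mul_zero] at this
    exact this.congr fun i => div_mul_cancel₀ _ (hne i)
  have hlog : Tendsto (fun i => (Complex.log (1 + u i) - (u i - u i ^ 2 / 2)) / (h i : ℂ) ^ 2) l
      (𝓝 0) := by
    have hb : Tendsto (fun i => ‖u i / h i‖ ^ 2 * ‖u i‖) l (𝓝 0) := by
      simpa using (huh.norm.pow 2).mul hu0.norm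
    refine squeeze_zero_norm' ?_ hb
    have hu1 : ∀ᶠ i in l, ‖u i‖ < 1 / 2 := by
      have := hu0.norm
      rw [norm_zero] at this
      exact this.eventually (gt_mem_nhds (by norm_num))
    filter_upwards [hu1] with i hi
    have ht := Complex.norm_log_sub_logTaylor_le 2 (z := u i) (by linarith)
    have et : Complex.logTaylor (2 + 1) (u i) = u i - u i ^ 2 / 2 := by
      simp [Complex.logTaylor, Finset.sum_range_succ]; ring
    rw [et] at ht
    have : (1 - ‖u i‖)⁻¹ ≤ 2 := by
      rw [inv_le_comm₀ (by linarith) (by norm_num)]; linarith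
    have h3 : ‖Complex.log (1 + u i) - (u i - u i ^ 2 / 2)‖ ≤ ‖u i‖ ^ 3 := by
      refine ht.trans ?_
      have h3 : 0 ≤ ‖u i‖ ^ 3 := by positivity
      norm_num
      nlinarith
    rw [norm_div, norm_pow, norm_div (u i), div_pow ‖u i‖]
    have hp : 0 < ‖(h i : ℂ)‖ := norm_pos_iff.2 (hne i)
    calc _ ≤ ‖u i‖ ^ 3 / ‖(h i : ℂ)‖ ^ 2 := div_le_div_of_nonneg_right h3 (by positivity)
      _ = _ := by ring
  have hdiff : Tendsto (fun i => (u i - firstOrder δ (h i) (x i) (D i)) / (h i : ℂ) ^ 2) l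
      (𝓝 (-(D₀ ^ 2 / 2) - Z * (δ / x₀))) := by
    have := (hw.sub (hz.mul hδx)).div hden one_ne_zero
    rw [div_one] at this
    refine this.congr' ?_
    filter_upwards [hxpos] with i hi
    have h1 := hne i
    have h2 : (x i : ℂ) ≠ 0 := by exact_mod_cast hi.ne'
    have h3 : (1 + h i * δ / x i : ℂ) ≠ 0 := by
      have : (0 : ℝ) < 1 + h i * δ / x i := by have := hpos i; positivity
      exact_mod_cast this.ne'
    have h4 : (δ : ℂ) / x i = ((1 + h i * δ / x i) - 1) / h i := by field_simp; ring
    simp only [Pi.div_apply, hu]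
    rw [h4]
    generalize (1 + h i * δ / x i : ℂ) = d at h3 ⊢
    field_simp
    ring
  have hfin := (hlog.sub ((huh.pow 2).div_const 2)).add hdiff
  have hval : (0 - Z ^ 2 / 2 + (-(D₀ ^ 2 / 2) - Z * (δ / x₀)) : ℂ) =
      -(1 / 2) * (D₀ ^ 2 / Complex.sin x₀ ^ 2 - δ ^ 2 / (x₀ : ℂ) ^ 2) := by
    have hsC : Complex.sin x₀ ≠ 0 := by rw [← Complex.ofReal_sin]; exact_mod_cast hs
    have hsq := Complex.sin_sq_add_cos_sq (x₀ : ℂ)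
    rw [hZ, cot_eq_cos_div_sin]
    push_cast
    field_simp
    linear_combination (-(D₀ ^ 2 * (x₀ : ℂ) ^ 2)) * hsq
  rw [hval] at hfin
  refine hfin.congr' ?_
  filter_upwards [hxpos, hsin] with i hi hsi
  rw [logRemainder, reducedFactor_eq _ hsi hi (hpos i) hδ]
  change _ = (Complex.log (1 + u i) - _) / _
  have := hne i
  field_simp
  ring

/-! ### Factorization of the double product -/

theorem prod_Icc_Ico_eq_prod_range {M : Type*} [CommMonoid M] (f : ℕ → ℕ → M) (L : ℕ) :
    ∏ i ∈ Finset.Icc 1 L, ∏ j ∈ Finset.Ico 1 i, f i j =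
      ∏ i ∈ Finset.range L, ∏ j ∈ Finset.range i, f (i + 1) (j + 1) := by
  rw [← Finset.Ico_add_one_right_eq_Icc, Finset.prod_Ico_eq_prod_range]
  refine Finset.prod_congr (by simp) fun i _ => ?_
  rw [Finset.prod_Ico_eq_prod_range, add_comm 1 i]
  refine Finset.prod_congr (by simp) fun j _ => ?_
  rw [add_comm 1 j]

/-- There are `m` pairs `j < i < L` with `L - (i - j) = m`. -/
theorem prod_range_prod_range_sub {M : Type*} [CommMonoid M] (f : ℕ → M) (L : ℕ) :
    ∏ i ∈ Finset.range L, ∏ j ∈ Finset.range i, f (L - (i - j)) =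
      ∏ m ∈ Finset.range L, f m ^ m := by
  induction L with
  | zero => simp
  | succ L ih =>
    rw [Finset.prod_range_succ', Finset.prod_range_succ (fun m => f m ^ m), ← ih]
    simp only [Finset.range_zero, Finset.prod_empty, mul_one]
    have : ∀ i ∈ Finset.range L, ∏ j ∈ Finset.range (i + 1), f (L + 1 - (i + 1 - j)) =
        (∏ j ∈ Finset.range i, f (L - (i - j))) * f L := by
      intro i _
      rw [Finset.prod_range_succ]
      congr 1
      · refine Finset.prod_congr rfl fun j hj => ?_
        have := Finset.mem_range.1 hj
        congr 1; omega
      · congr 1; omega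
    rw [Finset.prod_congr rfl this, Finset.prod_mul_distrib, Finset.prod_const, Finset.card_range]

/-- An odd function on the integers that is `L`-periodic sums to zero over any period. -/
theorem sum_range_sub_eq_zero_of_odd {h : ℤ → ℂ} {L : ℕ} (hodd : ∀ n, h (-n) = -h n)
    (hper : ∀ n, h (n - L) = h n) (i : ℕ) :
    ∑ j ∈ Finset.range L, h (i - j - 1) = 0 := by
  have step : ∀ i : ℕ, ∑ j ∈ Finset.range L, h ((i + 1 : ℕ) - j - 1) =
      ∑ j ∈ Finset.range L, h (i - j - 1) := by
    intro i
    have h1 := Finset.sum_range_succ (fun j : ℕ => h (i - j)) L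
    rw [Finset.sum_range_succ', hper] at h1
    simp only [Nat.cast_zero, sub_zero, add_left_inj] at h1
    convert h1.symm using 2 <;> · congr 1; push_cast; ring
  have all : ∀ i : ℕ, ∑ j ∈ Finset.range L, h (i - j - 1) =
      ∑ j ∈ Finset.range L, h ((0 : ℕ) - j - 1) := by
    intro i
    induction i with
    | zero => rfl
    | succ i ih => rw [step, ih]
  have h0 : ∑ j ∈ Finset.range L, h ((0 : ℕ) - j - 1) = -∑ j ∈ Finset.range L, h (j + 1) := by
    rw [← Finset.sum_neg_distrib]
    refine Finset.sum_congr rfl fun j _ => ?_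
    rw [← hodd]; congr 1; push_cast; ring
  have h1 : ∑ j ∈ Finset.range L, h ((L + 1 : ℕ) - j - 1) = ∑ j ∈ Finset.range L, h (j + 1) := by
    rw [← Finset.sum_range_reflect]
    refine Finset.sum_congr rfl fun j hj => ?_
    have := Finset.mem_range.1 hj
    congr 1; omega
  have h2 := all (L + 1)
  rw [h1, h0] at h2
  rw [all i, h0]
  have h3 : (2 : ℂ) * ∑ j ∈ Finset.range L, h (j + 1) = 0 := by linear_combination h2
  simpa using h3

/-- The first order terms cancel exactly, because an odd periodic kernel has zero mean. -/
theorem sum_sub_mul_eq_zero_of_odd {h : ℤ → ℂ} {L : ℕ} (hodd : ∀ n, h (-n) = -h n)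
    (hper : ∀ n, h (n - L) = h n) (a : ℕ → ℂ) :
    ∑ i ∈ Finset.range L, ∑ j ∈ Finset.range i, (a i - a j) * h (i - j) = 0 := by
  have hz : h 0 = 0 := by
    have := hodd 0
    rw [neg_zero] at this
    have h3 : (2 : ℂ) * h 0 = 0 := by linear_combination this
    simpa using h3
  have e : ∀ i ∈ Finset.range L, ∑ j ∈ Finset.range i, (a i - a j) * h (i - j) =
      ∑ j ∈ Finset.range L, ((if j < i then a i * h (i - j) else 0) -
        (if j < i then a j * h (i - j) else 0)) := by
    intro i hi
    have hiL := Finset.mem_range.1 hi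
    have hf : Finset.range i = (Finset.range L).filter (· < i) := by
      ext j; simp; omega
    rw [hf, Finset.sum_filter]
    refine Finset.sum_congr rfl fun j _ => ?_
    split_ifs <;> ring
  rw [Finset.sum_congr rfl e]
  simp only [Finset.sum_sub_distrib]
  rw [Finset.sum_comm (f := fun i j : ℕ => if j < i then a j * h (i - j) else 0)]
  rw [← Finset.sum_sub_distrib]
  refine Finset.sum_eq_zero fun i _ => ?_
  rw [← Finset.sum_sub_distrib]
  have e2 : ∀ j ∈ Finset.range L, ((if j < i then a i * h (i - j) else 0) -
      (if i < j then a i * h (j - i) else 0)) = a i * h ((i + 1 : ℕ) - j - 1) := by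
    intro j _
    have e3 : (((i + 1 : ℕ) : ℤ) - j - 1) = i - j := by push_cast; ring
    rw [e3]
    rcases lt_trichotomy j i with hji | hji | hji
    · simp [hji, hji.le]
    · simp [hji, hz]
    · have : h (i - j) = -h (j - i) := by rw [← hodd]; congr 1; ring
      simp [hji, hji.le, this]
  rw [Finset.sum_congr rfl e2, ← Finset.mul_sum, sum_range_sub_eq_zero_of_odd hodd hper, mul_zero]

/-- The distance `π - π (i - j) / L` of the half difference of two lattice momenta to `π`. -/
noncomputable def cornerAngle (L i j : ℕ) : ℝ := π - π / L * ((i : ℝ) - j)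

/-- The increment of `ν` between two lattice momenta, indexed from zero. -/
noncomputable def increment (ν : ℝ → ℂ) (L i j : ℕ) : ℂ :=
  ν (momentum L (i + 1)) - ν (momentum L (j + 1))

/-- The second order remainder attached to the pair `(i, j)` of lattice sites. -/
noncomputable def latticeRemainder (ν : ℝ → ℂ) (δ : ℝ) (L i j : ℕ) : ℂ :=
  logRemainder δ (π / L) (cornerAngle L i j) (increment ν L i j)

theorem sum_increment_mul_cot (ν : ℝ → ℂ) (L : ℕ) :
    ∑ i ∈ Finset.range L, ∑ j ∈ Finset.range i,
      increment ν L i j * ((cot (cornerAngle L i j) : ℝ) : ℂ) = 0 := by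
  rcases Nat.eq_zero_or_pos L with rfl | hL
  · simp
  have hL' : (L : ℝ) ≠ 0 := by positivity
  have := sum_sub_mul_eq_zero_of_odd (L := L)
    (h := fun n : ℤ => ((cot (π - π / L * n) : ℝ) : ℂ)) ?_ ?_ (fun i => ν (momentum L (i + 1)))
  · simpa [increment, cornerAngle] using this
  · intro n
    have : π - π / L * ((-n : ℤ) : ℝ) = π / L * n + π := by push_cast; ring
    simp only [this]
    simp only [cot_eq_cos_div_sin, cos_pi_sub, sin_pi_sub, cos_add_pi, sin_add_pi]
    push_cast; ring
  · intro n
    have : π - π / L * ((n - L : ℤ) : ℝ) = (π - π / L * n) + π := by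
      push_cast; field_simp; ring
    simp only [this]
    simp only [cot_eq_cos_div_sin, cos_add_pi, sin_add_pi]
    push_cast; ring

theorem momentum_succ {L : ℕ} (hL : 0 < L) (i : ℕ) :
    momentum L (i + 1) = -π + 2 * π / L * (i + 1 / 2) := by
  have : (L : ℝ) ≠ 0 := by positivity
  rw [momentum]; push_cast; field_simp; ring

section lattice
variable {L i j : ℕ}

theorem le_cornerAngle (hiL : i < L) : π / L ≤ cornerAngle L i j := by
  have hL : (0 : ℝ) < L := by exact_mod_cast (by omega : 0 < L)
  have h1 : (i : ℝ) + 1 ≤ L := by exact_mod_cast hiL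
  have h2 : (0 : ℝ) ≤ j := by positivity
  have : cornerAngle L i j = π / L * (L - (i - j)) := by rw [cornerAngle]; field_simp
  rw [this]
  have hp : 0 < π / L := by positivity
  nlinarith

theorem cornerAngle_lt (hji : j < i) (hiL : i < L) : cornerAngle L i j < π := by
  have hL : (0 : ℝ) < L := by exact_mod_cast (by omega : 0 < L)
  have h1 : (0 : ℝ) < i - j := by rw [sub_pos]; exact_mod_cast hji
  rw [cornerAngle]
  have : 0 < π / L * (i - j) := by positivity
  linarith

variable {ν : ℝ → ℂ} {K : NNReal} {δ : ℝ}

theorem norm_increment_le (hν : LipschitzWith K ν) (hji : j < i) (hiL : i < L) :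
    ‖increment ν L i j‖ ≤ 2 * K * (π - cornerAngle L i j) := by
  have hL : (0 : ℝ) < L := by exact_mod_cast (by omega : 0 < L)
  have h := hν.norm_sub_le (momentum L (i + 1)) (momentum L (j + 1))
  refine h.trans_eq ?_
  have hL0 : 0 < L := by omega
  have h1 : (0 : ℝ) < i - j := by rw [sub_pos]; exact_mod_cast hji
  have : momentum L (i + 1) - momentum L (j + 1) = 2 * π / L * (i - j) := by
    rw [momentum_succ hL0, momentum_succ hL0]; ring
  rw [this, norm_of_nonneg (by positivity), cornerAngle]
  ring

theorem norm_increment_sub_le (hν : LipschitzWith K ν) (hwind : ν π - ν (-π) = δ) (hiL : i < L)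
    (hjL : j < L) :
    ‖increment ν L i j - δ‖ ≤ 2 * K * cornerAngle L i j := by
  have hL : (0 : ℝ) < L := by exact_mod_cast (by omega : 0 < L)
  have hL0 : 0 < L := by omega
  have e : increment ν L i j - δ =
      (ν (momentum L (i + 1)) - ν π) + (ν (-π) - ν (momentum L (j + 1))) := by
    rw [increment, ← hwind]; ring
  rw [e]
  refine (norm_add_le_of_le (hν.norm_sub_le _ _) (hν.norm_sub_le _ _)).trans_eq ?_
  have e1 : momentum L (i + 1) - π = -(2 * π / L * (L - i - 1 / 2)) := by
    rw [momentum_succ hL0]; field_simp; ring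
  have e2 : -π - momentum L (j + 1) = -(2 * π / L * (j + 1 / 2)) := by
    rw [momentum_succ hL0]; ring
  have h1 : (i : ℝ) + 1 ≤ L := by exact_mod_cast hiL
  have h2 : (0 : ℝ) ≤ L - i - 1 / 2 := by linarith
  rw [e1, e2, norm_neg, norm_neg, norm_of_nonneg (by positivity), norm_of_nonneg (by positivity),
    cornerAngle]
  field_simp
  ring

theorem sin_div_sin_eq (hδ : 0 ≤ δ) (hji : j < i) (hiL : i < L)
    (hne : reducedFactor δ (π / L) (cornerAngle L i j) (increment ν L i j) ≠ 0) :
    Complex.sin ((π : ℂ) / (L : ℂ) * (((i + 1 : ℕ) : ℂ) - ((j + 1 : ℕ) : ℂ)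
        - ν (momentum L (i + 1)) + ν (momentum L (j + 1)))) /
      Complex.sin ((π : ℂ) * (((i + 1 : ℕ) : ℂ) - ((j + 1 : ℕ) : ℂ)) / (L : ℂ)) =
    ((1 + δ / ((L - (i - j) : ℕ) : ℂ)) * Complex.exp (-(δ / ((L - (i - j) : ℕ) : ℂ)))) *
      Complex.exp (latticeRemainder ν δ L i j + π / L * (increment ν L i j *
        ((cot (cornerAngle L i j) : ℝ) : ℂ))) := by
  have hL : (0 : ℝ) < L := by exact_mod_cast (by omega : 0 < L)
  have hLC : (L : ℂ) ≠ 0 := by exact_mod_cast hL.ne'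
  have hπC : (π : ℂ) ≠ 0 := by exact_mod_cast pi_ne_zero
  have hm : (0 : ℝ) < ((L - (i - j) : ℕ) : ℝ) := by exact_mod_cast (by omega : 0 < L - (i - j))
  have hmC : ((L - (i - j) : ℕ) : ℂ) ≠ 0 := by exact_mod_cast hm.ne'
  have hmcast : ((L - (i - j) : ℕ) : ℝ) = L - (i - j) := by
    rw [Nat.cast_sub (by omega), Nat.cast_sub hji.le]
  have hx : cornerAngle L i j = π / L * ((L - (i - j) : ℕ) : ℝ) := by
    rw [hmcast, cornerAngle]; field_simp
  have hdiv : ((π / L : ℝ) : ℂ) * δ / ((cornerAngle L i j : ℝ) : ℂ) =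
      δ / ((L - (i - j) : ℕ) : ℂ) := by
    rw [hx, Complex.ofReal_mul, Complex.ofReal_natCast]
    have : ((π / L : ℝ) : ℂ) ≠ 0 := by push_cast; exact div_ne_zero hπC hLC
    field_simp
  have hpos : (1 + δ / ((L - (i - j) : ℕ) : ℂ) : ℂ) ≠ 0 := by
    have : (0 : ℝ) < 1 + δ / ((L - (i - j) : ℕ) : ℝ) := by positivity
    exact_mod_cast this.ne'
  -- Reflecting at `π` turns the singular corner `i - j → L` into `x → 0`.
  have e1 : Complex.sin ((π : ℂ) / (L : ℂ) * (((i + 1 : ℕ) : ℂ) - ((j + 1 : ℕ) : ℂ)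
        - ν (momentum L (i + 1)) + ν (momentum L (j + 1)))) =
      Complex.sin ((cornerAngle L i j : ℝ) + (π / L : ℝ) * increment ν L i j) := by
    rw [← Complex.sin_pi_sub]
    congr 1
    rw [cornerAngle, increment]; push_cast; ring
  have e2 : Complex.sin ((π : ℂ) * (((i + 1 : ℕ) : ℂ) - ((j + 1 : ℕ) : ℂ)) / (L : ℂ)) =
      Complex.sin (cornerAngle L i j : ℝ) := by
    rw [← Complex.sin_pi_sub]
    congr 1
    rw [cornerAngle]; push_cast; ring
  have e3 : latticeRemainder ν δ L i j + π / L * (increment ν L i j *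
        ((cot (cornerAngle L i j) : ℝ) : ℂ)) =
      Complex.log (reducedFactor δ (π / L) (cornerAngle L i j) (increment ν L i j)) +
        δ / ((L - (i - j) : ℕ) : ℂ) := by
    rw [latticeRemainder, logRemainder, firstOrder, ← hdiv]
    push_cast; ring
  rw [e1, e2, e3, Complex.exp_add, Complex.exp_log hne, Complex.exp_neg, reducedFactor, hdiv]
  have := Complex.exp_ne_zero (δ / ((L - (i - j) : ℕ) : ℂ))
  generalize Complex.sin _ / Complex.sin _ = s
  generalize (1 + δ / ((L - (i - j) : ℕ) : ℂ) : ℂ) = d at hpos ⊢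
  field_simp

/-- The double product is a product over the corner, which carries the Barnes function and the
power of `L`, times the exponential of the sum of the second order remainders. -/
theorem doubleProduct_eq (hδ : 0 ≤ δ) (L : ℕ)
    (hne : ∀ i j, j < i → i < L →
      reducedFactor δ (π / L) (cornerAngle L i j) (increment ν L i j) ≠ 0) :
    doubleProduct ν L =
      (∏ m ∈ Finset.range L, ((1 + δ / (m : ℂ)) * Complex.exp (-(δ / (m : ℂ)))) ^ m) *
      Complex.exp (∑ i ∈ Finset.range L, ∑ j ∈ Finset.range i, latticeRemainder ν δ L i j) := by
  rw [doubleProduct, prod_Icc_Ico_eq_prod_range, ← prod_range_prod_range_sub]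
  have h0 := sum_increment_mul_cot ν L
  have : ∑ i ∈ Finset.range L, ∑ j ∈ Finset.range i, latticeRemainder ν δ L i j =
      ∑ i ∈ Finset.range L, ∑ j ∈ Finset.range i, (latticeRemainder ν δ L i j +
        π / L * (increment ν L i j * ((cot (cornerAngle L i j) : ℝ) : ℂ))) := by
    simp only [Finset.sum_add_distrib, ← Finset.mul_sum, h0, mul_zero, add_zero]
  -- The first order terms may be put into the exponent for free, since their sum vanishes.
  rw [this]
  simp only [Complex.exp_sum, ← Finset.prod_mul_distrib]
  refine Finset.prod_congr rfl fun i hi => Finset.prod_congr rfl fun j hj => ?_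
  rw [Finset.mem_range] at hi hj
  exact sin_div_sin_eq hδ hj hi (hne i j hj hi)

end lattice

/-! ### The corner product and the Barnes function -/

/-- The factors of the Weierstrass product of the Barnes function at `1 + δ`. -/
noncomputable def barnesFactor (δ : ℝ) (k : ℕ) : ℝ :=
  (1 + δ / ((k : ℝ) + 1)) ^ (k + 1) * exp (δ ^ 2 / (2 * ((k : ℝ) + 1)) - δ)

section barnes
variable {δ : ℝ}

theorem barnesFactor_pos (hδ : 0 ≤ δ) (k : ℕ) : 0 < barnesFactor δ k := by
  rw [barnesFactor]; positivity

theorem summable_log_barnesFactor (hδ : 0 ≤ δ) : Summable fun k => log (barnesFactor δ k) := by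
  have hs : Summable fun k : ℕ => 2 * δ ^ 3 * (1 / ((k : ℝ) + 1) ^ 2) := by
    have := (summable_nat_add_iff 1).2 (Real.summable_one_div_nat_pow.2 one_lt_two)
    exact (by simpa using this : Summable fun k : ℕ => 1 / ((k : ℝ) + 1) ^ 2).mul_left _
  refine Summable.of_norm_bounded_eventually_nat hs ?_
  obtain ⟨N, hN⟩ := exists_nat_ge (2 * δ)
  filter_upwards [eventually_ge_atTop N] with k hk
  have hk' : (N : ℝ) ≤ k := by exact_mod_cast hk
  have hk1 : (0 : ℝ) < (k : ℝ) + 1 := by positivity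
  set y : ℝ := δ / ((k : ℝ) + 1) with hy
  have hy0 : 0 ≤ y := by positivity
  have hy1 : y ≤ 1 / 2 := by rw [hy, div_le_iff₀ hk1]; linarith
  have hlog : log (barnesFactor δ k) =
      ((k : ℝ) + 1) * (-y + y ^ 2 / 2 + log (1 + y)) := by
    rw [barnesFactor, log_mul (by positivity) (exp_ne_zero _), log_pow, log_exp, ← hy]
    have : δ = y * ((k : ℝ) + 1) := by rw [hy]; field_simp
    rw [this]; push_cast; field_simp; ring
  have hb := Real.abs_log_sub_add_sum_range_le (x := -y) (by rw [abs_neg, abs_of_nonneg hy0]; linarith) 2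
  simp only [Finset.sum_range_succ, Finset.range_zero, Finset.sum_empty, abs_neg,
    abs_of_nonneg hy0] at hb
  have hb' : |-y + y ^ 2 / 2 + log (1 + y)| ≤ 2 * y ^ 3 := by
    have e : (-y + y ^ 2 / 2 + log (1 + y)) = (0 + (-y) ^ (0 + 1) / (((0 : ℕ) : ℝ) + 1) +
        (-y) ^ (1 + 1) / (((1 : ℕ) : ℝ) + 1) + log (1 - -y)) := by
      rw [sub_neg_eq_add]; norm_num
    rw [e]
    refine hb.trans ?_
    rw [div_le_iff₀ (by linarith)]
    calc y ^ (2 + 1) = 2 * y ^ 3 * (1 / 2) := by ring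
      _ ≤ 2 * y ^ 3 * (1 - y) := by gcongr; linarith
  rw [hlog, norm_mul, norm_of_nonneg hk1.le, norm_eq_abs]
  calc ((k : ℝ) + 1) * |-y + y ^ 2 / 2 + log (1 + y)| ≤ ((k : ℝ) + 1) * (2 * y ^ 3) := by gcongr
    _ = 2 * δ ^ 3 * (1 / ((k : ℝ) + 1) ^ 2) := by rw [hy]; field_simp

theorem hasProd_barnesFactor (hδ : 0 ≤ δ) :
    HasProd (barnesFactor δ) (∏' k, barnesFactor δ k) :=
  (Real.multipliable_of_summable_log (barnesFactor_pos hδ) (summable_log_barnesFactor hδ)).hasProd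

theorem barnesG_one_add (δ : ℝ) :
    barnesG (1 + δ) = (2 * π) ^ (δ / 2) * exp (-(δ + δ ^ 2 * (1 + eulerMascheroniConstant)) / 2) *
      ∏' k, barnesFactor δ k := by
  rw [barnesG, add_sub_cancel_left]; rfl

theorem barnesG_one_add_pos (hδ : 0 ≤ δ) : 0 < barnesG (1 + δ) := by
  rw [barnesG_one_add, ← Real.rexp_tsum_eq_tprod (barnesFactor_pos hδ)
    (summable_log_barnesFactor hδ)]
  positivity

/-- The corner product differs from the Weierstrass product by the divergent `δ² / 2` times the
harmonic sum. -/
theorem prod_range_eq_prod_barnesFactor (δ : ℝ) (n : ℕ) :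
    ∏ m ∈ Finset.range (n + 1), ((1 + δ / (m : ℝ)) * exp (-(δ / (m : ℝ)))) ^ m =
      (∏ k ∈ Finset.range n, barnesFactor δ k) * exp (-(δ ^ 2 / 2 * harmonic n)) := by
  rw [Finset.prod_range_succ']
  simp only [pow_zero, mul_one]
  induction n with
  | zero => simp
  | succ n ih =>
    rw [Finset.prod_range_succ, ih, Finset.prod_range_succ, harmonic_succ, barnesFactor, mul_pow,
      ← exp_nat_mul]
    have : exp (-(δ ^ 2 / 2 * ((harmonic n + ((n + 1 : ℕ) : ℚ)⁻¹ : ℚ) : ℝ))) =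
        exp (-(δ ^ 2 / 2 * harmonic n)) * exp (-(δ ^ 2 / (2 * ((n : ℝ) + 1)))) := by
      rw [← exp_add]; congr 1; push_cast; field_simp; ring
    rw [this]
    have h2 : exp (δ ^ 2 / (2 * ((n : ℝ) + 1)) - δ) =
        exp (δ ^ 2 / (2 * ((n : ℝ) + 1))) * exp (-δ) := by rw [← exp_add, sub_eq_add_neg]
    have h3 : ((n + 1 : ℕ) : ℝ) * -(δ / ((n + 1 : ℕ) : ℝ)) = -δ := by field_simp
    rw [h2, h3, exp_neg (δ ^ 2 / (2 * ((n : ℝ) + 1)))]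
    have := exp_ne_zero (δ ^ 2 / (2 * ((n : ℝ) + 1)))
    push_cast
    field_simp

/-- The corner product, asymptotically a power of `L` times a value of the Barnes function. -/
theorem tendsto_prod_mul_rpow (hδ : 0 ≤ δ) :
    Tendsto (fun L : ℕ => (∏ m ∈ Finset.range L, ((1 + δ / (m : ℝ)) * exp (-(δ / (m : ℝ)))) ^ m) *
      (L : ℝ) ^ (δ ^ 2 / 2)) atTop
      (𝓝 (barnesG (1 + δ) * exp (-(δ / 2) * log (2 * π) + δ / 2 + δ ^ 2 / 2))) := by
  rw [← tendsto_add_atTop_iff_nat 1]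
  have h1 := (hasProd_barnesFactor hδ).tendsto_prod_nat
  have h2 := (Real.tendsto_harmonic_sub_log_add_one.const_mul (-(δ ^ 2 / 2))).rexp
  have hval : barnesG (1 + δ) * exp (-(δ / 2) * log (2 * π) + δ / 2 + δ ^ 2 / 2) =
      (∏' k, barnesFactor δ k) * exp (-(δ ^ 2 / 2) * eulerMascheroniConstant) := by
    rw [barnesG_one_add, rpow_def_of_pos (by positivity)]
    have : exp (-(δ ^ 2 / 2) * eulerMascheroniConstant) = exp (log (2 * π) * (δ / 2)) *
        exp (-(δ + δ ^ 2 * (1 + eulerMascheroniConstant)) / 2) *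
        exp (-(δ / 2) * log (2 * π) + δ / 2 + δ ^ 2 / 2) := by
      rw [← exp_add, ← exp_add]; congr 1; ring
    rw [this]; ring
  rw [hval]
  refine (h1.mul h2).congr fun n => ?_
  rw [prod_range_eq_prod_barnesFactor, rpow_def_of_pos (by positivity), mul_assoc, ← exp_add]
  congr 2
  push_cast; ring

end barnes

/-! ### Convergence of the sum of remainders -/

/-- The index, counted from zero, of the lattice cell `(-π + 2π i / L, -π + 2π (i + 1) / L]` that
contains `q`. -/
noncomputable def cell (L : ℕ) (q : ℝ) : ℕ := ⌈(L : ℝ) * (q + π) / (2 * π)⌉₊ - 1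

theorem measurable_cell (L : ℕ) : Measurable (cell L) := by
  have h : Measurable fun n : ℕ => n - 1 := Measurable.of_discrete
  exact h.comp (Nat.measurable_ceil.comp (by fun_prop))

theorem cell_eq {L : ℕ} {q : ℝ} {i : ℕ} (h1 : (i : ℝ) < (L : ℝ) * (q + π) / (2 * π))
    (h2 : (L : ℝ) * (q + π) / (2 * π) ≤ i + 1) : cell L q = i := by
  have : ⌈(L : ℝ) * (q + π) / (2 * π)⌉₊ = i + 1 := by
    rw [Nat.ceil_eq_iff (by omega)]
    exact ⟨by simpa using h1, by exact_mod_cast h2⟩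
  rw [cell, this]; rfl

section cell
variable {L : ℕ} {q : ℝ}

theorem cell_lt_and_le (hL : 0 < L) (hq : q ∈ Set.Ioc (-π) π) :
    (cell L q : ℝ) < (L : ℝ) * (q + π) / (2 * π) ∧
      (L : ℝ) * (q + π) / (2 * π) ≤ cell L q + 1 := by
  have hp := pi_pos
  have hL' : (0 : ℝ) < L := by exact_mod_cast hL
  have hy : 0 < (L : ℝ) * (q + π) / (2 * π) := by
    have : 0 < q + π := by linarith [hq.1]
    positivity
  have hc : 0 < ⌈(L : ℝ) * (q + π) / (2 * π)⌉₊ := Nat.ceil_pos.2 hy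
  have e : (cell L q : ℝ) + 1 = ⌈(L : ℝ) * (q + π) / (2 * π)⌉₊ := by
    rw [cell]; exact_mod_cast Nat.sub_add_cancel hc
  have := Nat.ceil_lt_add_one hy.le
  have := Nat.le_ceil ((L : ℝ) * (q + π) / (2 * π))
  constructor <;> linarith

theorem cell_lt (hL : 0 < L) (hq : q ∈ Set.Ioc (-π) π) : cell L q < L := by
  have h := (cell_lt_and_le hL hq).1
  have hp := pi_pos
  have hL' : (0 : ℝ) < L := by exact_mod_cast hL
  have : (L : ℝ) * (q + π) / (2 * π) ≤ L := by
    rw [div_le_iff₀ (by positivity)]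
    have := hq.2
    nlinarith
  exact_mod_cast h.trans_le this

theorem cell_mono (L : ℕ) : Monotone (cell L) := by
  intro a b hab
  have hp := pi_pos
  exact Nat.sub_le_sub_right (Nat.ceil_mono (by gcongr)) 1

theorem tendsto_cell_div (hq : q ∈ Set.Ioc (-π) π) :
    Tendsto (fun L : ℕ => (cell L q : ℝ) / L) atTop (𝓝 ((q + π) / (2 * π))) := by
  have hp := pi_pos
  rw [← sub_zero ((q + π) / (2 * π))]
  have h1 : Tendsto (fun L : ℕ => (q + π) / (2 * π) - 1 / (L : ℝ)) atTop
      (𝓝 ((q + π) / (2 * π) - 0)) := tendsto_const_nhds.sub tendsto_one_div_atTop_nhds_zero_nat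
  have h2 : Tendsto (fun L : ℕ => (q + π) / (2 * π)) atTop (𝓝 ((q + π) / (2 * π) - 0)) := by simp
  refine tendsto_of_tendsto_of_tendsto_of_le_of_le' h1 h2 ?_ ?_ <;>
    filter_upwards [eventually_gt_atTop 0] with L hL <;>
    have hL' : (0 : ℝ) < L := by exact_mod_cast hL
  · have h := (cell_lt_and_le hL hq).2
    rw [le_div_iff₀ hL', sub_mul, one_div_mul_cancel hL'.ne']
    have : (q + π) / (2 * π) * L = (L : ℝ) * (q + π) / (2 * π) := by ring
    linarith
  · have h := (cell_lt_and_le hL hq).1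
    rw [div_le_iff₀ hL']
    have : (q + π) / (2 * π) * L = (L : ℝ) * (q + π) / (2 * π) := by ring
    linarith

theorem tendsto_momentum_cell (hq : q ∈ Set.Ioc (-π) π) :
    Tendsto (fun L : ℕ => momentum L (cell L q + 1)) atTop (𝓝 q) := by
  have hp := pi_pos
  have h := ((tendsto_cell_div hq).const_mul (2 * π)).const_add (-π)
  have h2 := h.add ((tendsto_one_div_atTop_nhds_zero_nat (𝕜 := ℝ)).const_mul π)
  have e : -π + 2 * π * ((q + π) / (2 * π)) + π * 0 = q := by field_simp; ring
  rw [e] at h2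
  refine h2.congr' ?_
  filter_upwards [eventually_gt_atTop 0] with L hL
  have hL' : (0 : ℝ) < L := by exact_mod_cast hL
  rw [momentum_succ hL]; field_simp; ring

theorem tendsto_cornerAngle_cell {k : ℝ} (hq : q ∈ Set.Ioc (-π) π) (hk : k ∈ Set.Ioc (-π) π) :
    Tendsto (fun L : ℕ => cornerAngle L (cell L q) (cell L k)) atTop (𝓝 (π - (q - k) / 2)) := by
  have hp := pi_pos
  have h := (((tendsto_cell_div hq).sub (tendsto_cell_div hk)).const_mul π).const_sub π
  have e : π - π * ((q + π) / (2 * π) - (k + π) / (2 * π)) = π - (q - k) / 2 := by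
    field_simp; ring
  rw [e] at h
  refine h.congr fun L => ?_
  rw [cornerAngle]; ring

/-- The corner angle of the cell of `(q, k)` dominates the distance of `(q, k)` to the corner
`(π, -π)`. -/
theorem le_cornerAngle_cell {k : ℝ} (hL : 0 < L) (hq : q ∈ Set.Ioc (-π) π)
    (hk : k ∈ Set.Ioc (-π) π) :
    ((π - q) + (π + k)) / 4 ≤ cornerAngle L (cell L q) (cell L k) := by
  have hp := pi_pos
  have hL' : (0 : ℝ) < L := by exact_mod_cast hL
  have h1 := (cell_lt_and_le hL hq).1
  have h2 := (cell_lt_and_le hL hk).2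
  have h3 : π / L ≤ cornerAngle L (cell L q) (cell L k) := le_cornerAngle (cell_lt hL hq)
  have h4 : π / L * ((cell L q : ℝ) - cell L k) ≤ π / L * ((L : ℝ) * (q + π) / (2 * π) -
      ((L : ℝ) * (k + π) / (2 * π) - 1)) := by
    gcongr; linarith
  have h5 : π / L * ((L : ℝ) * (q + π) / (2 * π) -
      ((L : ℝ) * (k + π) / (2 * π) - 1)) = (q - k) / 2 + π / L := by
    field_simp; ring
  rw [h5] at h4
  rw [cornerAngle] at h3 ⊢
  linarith

end cell

theorem integral_cell {L : ℕ} (hL : 0 < L) (φ : ℕ → ℂ) :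
    ∫ q in Set.Ioc (-π) π, φ (cell L q) = (2 * π / L : ℝ) * ∑ i ∈ Finset.range L, φ i := by
  have hp := pi_pos
  have hL' : (0 : ℝ) < L := by exact_mod_cast hL
  set a : ℕ → ℝ := fun k => -π + 2 * π / L * k with ha
  have hstep : ∀ k, a k ≤ a (k + 1) := fun k => by
    simp only [ha]; push_cast; gcongr; linarith
  have hcell : ∀ k, ∀ q ∈ Set.Ioc (a k) (a (k + 1)), φ (cell L q) = φ k := by
    intro k q hq
    congr 1
    obtain ⟨h1, h2⟩ := hq
    simp only [ha] at h1 h2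
    push_cast at h2
    refine cell_eq ?_ ?_
    · rw [lt_div_iff₀ (by positivity)]
      have : 2 * π / L * k < q + π := by linarith
      rw [div_mul_eq_mul_div, div_lt_iff₀ hL'] at this
      linarith
    · rw [div_le_iff₀ (by positivity)]
      have : q + π ≤ 2 * π / L * (k + 1) := by linarith
      rw [div_mul_eq_mul_div, le_div_iff₀ hL'] at this
      linarith
  have hint : ∀ k < L, IntervalIntegrable (fun q => φ (cell L q)) volume (a k) (a (k + 1)) := by
    intro k _
    rw [intervalIntegrable_iff_integrableOn_Ioc_of_le (hstep k)]
    exact (integrableOn_congr_fun (hcell k) measurableSet_Ioc).2 (by simp)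
  have hsum := intervalIntegral.sum_integral_adjacent_intervals hint
  have h0 : a 0 = -π := by simp [ha]
  have hend : a L = π := by simp only [ha]; field_simp; ring
  rw [h0, hend, intervalIntegral.integral_of_le (by linarith)] at hsum
  rw [← hsum, Finset.mul_sum]
  refine Finset.sum_congr rfl fun k _ => ?_
  rw [intervalIntegral.integral_of_le (hstep k), setIntegral_congr_fun measurableSet_Ioc (hcell k),
    ← intervalIntegral.integral_of_le (hstep k), intervalIntegral.integral_const]
  have : a (k + 1) - a k = 2 * π / L := by simp only [ha]; push_cast; ring
  rw [this, Complex.real_smul]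

/-- Lebesgue measure on the Brillouin zone `(-π, π]`. -/
noncomputable def zoneMeasure : Measure ℝ := volume.restrict (Set.Ioc (-π) π)

instance : IsFiniteMeasure zoneMeasure := by unfold zoneMeasure; infer_instance

theorem integral_prod_cell {L : ℕ} (hL : 0 < L) (φ : ℕ → ℕ → ℂ)
    (hint : Integrable (fun p : ℝ × ℝ => φ (cell L p.1) (cell L p.2))
      (zoneMeasure.prod zoneMeasure)) :
    ∫ p, φ (cell L p.1) (cell L p.2) ∂(zoneMeasure.prod zoneMeasure) =
      (2 * π / L : ℝ) ^ 2 * ∑ i ∈ Finset.range L, ∑ j ∈ Finset.range L, φ i j := by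
  rw [integral_prod _ hint]
  simp only [zoneMeasure]
  simp_rw [integral_cell hL (φ _)]
  rw [integral_cell hL (fun i => ((2 * π / L : ℝ) : ℂ) * ∑ j ∈ Finset.range L, φ i j),
    ← Finset.mul_sum]
  ring

theorem ae_mem_zone :
    ∀ᵐ p ∂(zoneMeasure.prod zoneMeasure), p.1 ∈ Set.Ioo (-π) π ∧ p.2 ∈ Set.Ioo (-π) π := by
  have h : ∀ᵐ q ∂zoneMeasure, q ∈ Set.Ioo (-π) π := by
    rw [zoneMeasure, ← Measure.restrict_congr_set Ioo_ae_eq_Ioc]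
    exact ae_restrict_mem measurableSet_Ioo
  filter_upwards [Measure.quasiMeasurePreserving_fst.ae h,
    Measure.quasiMeasurePreserving_snd.ae h] with p h1 h2 using ⟨h1, h2⟩

/-- An integrable majorant of the inverse distance to the corner `(π, -π)`. -/
noncomputable def cornerMajorant (p : ℝ × ℝ) : ℝ :=
  (π - p.1) ^ (-(1 / 2) : ℝ) * (π + p.2) ^ (-(1 / 2) : ℝ)

theorem integrable_cornerMajorant :
    Integrable cornerMajorant (zoneMeasure.prod zoneMeasure) := by
  have hp := pi_pos
  have h0 : IntervalIntegrable (fun x : ℝ => x ^ (-(1 / 2) : ℝ)) volume 0 (2 * π) :=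
    intervalIntegral.intervalIntegrable_rpow' (by norm_num)
  have h1 : Integrable (fun q : ℝ => (π - q) ^ (-(1 / 2) : ℝ)) zoneMeasure := by
    rw [zoneMeasure, ← IntegrableOn, ← intervalIntegrable_iff_integrableOn_Ioc_of_le (by linarith)]
    have := (h0.comp_sub_left π).symm
    convert this using 1 <;> ring
  have h2 : Integrable (fun q : ℝ => (π + q) ^ (-(1 / 2) : ℝ)) zoneMeasure := by
    rw [zoneMeasure, ← IntegrableOn, ← intervalIntegrable_iff_integrableOn_Ioc_of_le (by linarith)]
    have := h0.comp_add_left π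
    convert this using 1 <;> ring
  exact h1.mul_prod h2

theorem inv_le_cornerMajorant {p : ℝ × ℝ} (h1 : p.1 ∈ Set.Ioo (-π) π) (h2 : p.2 ∈ Set.Ioo (-π) π)
    {x : ℝ} (hx : ((π - p.1) + (π + p.2)) / 4 ≤ x) : 1 / x ≤ 2 * cornerMajorant p := by
  have ha : 0 < π - p.1 := by linarith [h1.2]
  have hb : 0 < π + p.2 := by linarith [h2.1]
  have hsa := Real.sq_sqrt ha.le
  have hsb := Real.sq_sqrt hb.le
  have hpa := Real.sqrt_pos.2 ha
  have hpb := Real.sqrt_pos.2 hb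
  rw [cornerMajorant, rpow_neg ha.le, rpow_neg hb.le, ← sqrt_eq_rpow, ← sqrt_eq_rpow]
  have : √(π - p.1) * √(π + p.2) / 2 ≤ x := by
    nlinarith [sq_nonneg (√(π - p.1) - √(π + p.2))]
  calc 1 / x ≤ 1 / (√(π - p.1) * √(π + p.2) / 2) :=
        one_div_le_one_div_of_le (by positivity) this
    _ = _ := by field_simp

/-- The density of the limit of the sum of the second order remainders. -/
noncomputable def remainderDensity (ν : ℝ → ℂ) (δ : ℝ) (p : ℝ × ℝ) : ℂ :=
  if p.2 < p.1 then
    -(1 / 8) * ((ν p.1 - ν p.2) ^ 2 / Complex.sin ((π - (p.1 - p.2) / 2 : ℝ) : ℂ) ^ 2 -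
      δ ^ 2 / ((π - (p.1 - p.2) / 2 : ℝ) : ℂ) ^ 2)
  else 0

/-- The step function on the zone whose integral is the sum of the second order remainders. -/
noncomputable def remainderStep (ν : ℝ → ℂ) (δ : ℝ) (L : ℕ) (p : ℝ × ℝ) : ℂ :=
  if cell L p.2 < cell L p.1 then
    (1 / 4) * (latticeRemainder ν δ L (cell L p.1) (cell L p.2) / ((π / L : ℝ) : ℂ) ^ 2)
  else 0

section limit
variable {ν : ℝ → ℂ} {K : NNReal} {δ : ℝ}

theorem measurable_remainderStep (ν : ℝ → ℂ) (δ : ℝ) (L : ℕ) :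
    Measurable (remainderStep ν δ L) := by
  have h : Measurable fun n : ℕ × ℕ => if n.2 < n.1 then
      (1 / 4) * (latticeRemainder ν δ L n.1 n.2 / ((π / L : ℝ) : ℂ) ^ 2) else 0 :=
    Measurable.of_discrete
  exact h.comp (((measurable_cell L).comp measurable_fst).prodMk
    ((measurable_cell L).comp measurable_snd))

theorem exists_norm_latticeRemainder_le (hν : LipschitzWith K ν) (hδ : 0 ≤ δ)
    (hwind : ν π - ν (-π) = δ) :
    ∃ C : ℝ, 0 ≤ C ∧ ∀ᶠ L : ℕ in atTop, ∀ i j, j < i → i < L →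
      reducedFactor δ (π / L) (cornerAngle L i j) (increment ν L i j) ≠ 0 ∧
      ‖latticeRemainder ν δ L i j‖ ≤ C * ((π / L) ^ 2 / cornerAngle L i j) := by
  obtain ⟨C, h₀, hC, hh₀, H⟩ := exists_norm_logRemainder_le K.coe_nonneg hδ
  refine ⟨C, hC, ?_⟩
  have ht := tendsto_const_div_atTop_nhds_zero_nat π
  filter_upwards [eventually_gt_atTop 0, ht.eventually (gt_mem_nhds hh₀)] with L hL hLh i j hji hiL
  have hL' : (0 : ℝ) < L := by exact_mod_cast hL
  exact H _ _ _ (by positivity) hLh.le (le_cornerAngle hiL) (cornerAngle_lt hji hiL)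
    (norm_increment_le hν hji hiL) (norm_increment_sub_le hν hwind hiL (hji.trans hiL))

theorem exists_norm_remainderStep_le (hν : LipschitzWith K ν) (hδ : 0 ≤ δ)
    (hwind : ν π - ν (-π) = δ) :
    ∃ C : ℝ, ∀ᶠ L : ℕ in atTop, ∀ᵐ p ∂(zoneMeasure.prod zoneMeasure),
      ‖remainderStep ν δ L p‖ ≤ C * cornerMajorant p := by
  obtain ⟨C, hC, H⟩ := exists_norm_latticeRemainder_le hν hδ hwind
  refine ⟨1 / 4 * (C * 2), ?_⟩
  filter_upwards [H, eventually_gt_atTop 0] with L hL hL0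
  filter_upwards [ae_mem_zone] with p hp
  have hL' : (0 : ℝ) < L := by exact_mod_cast hL0
  have h1 := Set.Ioo_subset_Ioc_self hp.1
  have h2 := Set.Ioo_subset_Ioc_self hp.2
  have hx := le_cornerAngle_cell hL0 h1 h2
  have hinv := inv_le_cornerMajorant hp.1 hp.2 hx
  have hx0 : 0 < cornerAngle L (cell L p.1) (cell L p.2) :=
    (by positivity : 0 < π / L).trans_le (le_cornerAngle (cell_lt hL0 h1))
  have hM : 0 ≤ 2 * cornerMajorant p := le_trans (by positivity) hinv
  rw [remainderStep]
  split_ifs with h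
  · have := (hL _ _ h (cell_lt hL0 h1)).2
    have hh : 0 < π / L := by positivity
    rw [norm_mul, norm_div _ (_ ^ 2), norm_pow, Complex.norm_real, norm_of_nonneg hh.le]
    have e : ‖(1 / 4 : ℂ)‖ = 1 / 4 := by norm_num
    rw [e, mul_assoc (1 / 4 : ℝ), mul_assoc C]
    gcongr
    rw [div_le_iff₀ (by positivity)]
    refine this.trans ?_
    calc C * ((π / L) ^ 2 / cornerAngle L (cell L p.1) (cell L p.2))
        = C * (1 / cornerAngle L (cell L p.1) (cell L p.2)) * (π / L) ^ 2 := by ring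
      _ ≤ _ := by gcongr
  · rw [norm_zero]
    have : 0 ≤ C * (2 * cornerMajorant p) := mul_nonneg hC hM
    linarith

theorem tendsto_remainderStep (hν : Continuous ν) (hδ : 0 ≤ δ) {p : ℝ × ℝ}
    (h1 : p.1 ∈ Set.Ioo (-π) π) (h2 : p.2 ∈ Set.Ioo (-π) π) :
    Tendsto (fun L => remainderStep ν δ L p) atTop (𝓝 (remainderDensity ν δ p)) := by
  have hp := pi_pos
  have h1' := Set.Ioo_subset_Ioc_self h1
  have h2' := Set.Ioo_subset_Ioc_self h2
  rcases lt_or_ge p.2 p.1 with h | h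
  · have hx := tendsto_cornerAngle_cell h1' h2'
    have hD : Tendsto (fun L => increment ν L (cell L p.1) (cell L p.2)) atTop
        (𝓝 (ν p.1 - ν p.2)) :=
      ((hν.tendsto _).comp (tendsto_momentum_cell h1')).sub
        ((hν.tendsto _).comp (tendsto_momentum_cell h2'))
    have hx0 : 0 < π - (p.1 - p.2) / 2 := by linarith [h1.2, h2.1]
    have hxπ : π - (p.1 - p.2) / 2 < π := by linarith
    have hlt : ∀ᶠ L in atTop, cell L p.2 < cell L p.1 := by
      filter_upwards [hx.eventually (gt_mem_nhds hxπ), eventually_gt_atTop 0] with L hL hL0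
      have hL' : (0 : ℝ) < L := by exact_mod_cast hL0
      rw [cornerAngle, sub_lt_self_iff, mul_pos_iff_of_pos_left (by positivity), sub_pos] at hL
      exact_mod_cast hL
    -- The mesh `π / L` is positive for `L ≠ 0` only, hence the shift by one.
    have ht := tendsto_logRemainder (l := atTop) (h := fun L : ℕ => π / ((L + 1 : ℕ) : ℝ)) hδ hx0
      hxπ (fun L => by positivity)
      ((tendsto_add_atTop_iff_nat 1).2 (tendsto_const_div_atTop_nhds_zero_nat π))
      ((tendsto_add_atTop_iff_nat 1).2 hx) ((tendsto_add_atTop_iff_nat 1).2 hD)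
    rw [tendsto_add_atTop_iff_nat (f := fun L : ℕ => logRemainder δ (π / (L : ℝ))
      (cornerAngle L (cell L p.1) (cell L p.2)) (increment ν L (cell L p.1) (cell L p.2)) /
      ((π / (L : ℝ) : ℝ) : ℂ) ^ 2) 1] at ht
    have ht2 := ht.const_mul (1 / 4)
    rw [remainderDensity, if_pos h]
    convert ht2.congr' ?_ using 2
    · ring
    · filter_upwards [hlt] with L hL
      rw [remainderStep, if_pos hL]; rfl
  · rw [remainderDensity, if_neg h.not_gt]
    refine tendsto_const_nhds.congr fun L => ?_
    rw [remainderStep, if_neg (cell_mono L h).not_gt]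

theorem sum_latticeRemainder_eq {L : ℕ} (hL : 0 < L)
    (hint : Integrable (remainderStep ν δ L) (zoneMeasure.prod zoneMeasure)) :
    ∑ i ∈ Finset.range L, ∑ j ∈ Finset.range i, latticeRemainder ν δ L i j =
      ∫ p, remainderStep ν δ L p ∂(zoneMeasure.prod zoneMeasure) := by
  have hLC : (L : ℂ) ≠ 0 := by exact_mod_cast hL.ne'
  have hπC : (π : ℂ) ≠ 0 := by exact_mod_cast pi_ne_zero
  have h := integral_prod_cell hL (fun i j => if j < i then
    (1 / 4) * (latticeRemainder ν δ L i j / ((π / L : ℝ) : ℂ) ^ 2) else 0) hint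
  refine Eq.trans ?_ h.symm
  rw [Finset.mul_sum]
  refine Finset.sum_congr rfl fun i hi => ?_
  rw [Finset.mem_range] at hi
  have hf : Finset.range i = (Finset.range L).filter (· < i) := by
    ext j; simp; omega
  rw [hf, Finset.sum_filter, Finset.mul_sum]
  refine Finset.sum_congr rfl fun j _ => ?_
  split_ifs
  · push_cast; field_simp; norm_num
  · simp

/-- Convergence of the sum of the second order remainders, by dominated convergence of the step
functions `remainderStep`. -/
theorem integrable_remainderDensity_and_tendsto (hν : LipschitzWith K ν) (hδ : 0 ≤ δ)
    (hwind : ν π - ν (-π) = δ) :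
    Integrable (remainderDensity ν δ) (zoneMeasure.prod zoneMeasure) ∧
    Tendsto (fun L => ∑ i ∈ Finset.range L, ∑ j ∈ Finset.range i, latticeRemainder ν δ L i j) atTop
      (𝓝 (∫ p, remainderDensity ν δ p ∂(zoneMeasure.prod zoneMeasure))) := by
  obtain ⟨C, hC⟩ := exists_norm_remainderStep_le hν hδ hwind
  have hmeas : ∀ L, AEStronglyMeasurable (remainderStep ν δ L) (zoneMeasure.prod zoneMeasure) :=
    fun L => (measurable_remainderStep ν δ L).aestronglyMeasurable
  have hlim : ∀ᵐ p ∂(zoneMeasure.prod zoneMeasure),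
      Tendsto (fun L => remainderStep ν δ L p) atTop (𝓝 (remainderDensity ν δ p)) := by
    filter_upwards [ae_mem_zone] with p hp
    exact tendsto_remainderStep hν.continuous hδ hp.1 hp.2
  have hbound := integrable_cornerMajorant.const_mul C
  constructor
  · obtain ⟨N, hN⟩ := eventually_atTop.1 hC
    refine hbound.mono' (aestronglyMeasurable_of_tendsto_ae atTop hmeas hlim) ?_
    have hall : ∀ᵐ p ∂(zoneMeasure.prod zoneMeasure), ∀ L, N ≤ L →
        ‖remainderStep ν δ L p‖ ≤ C * cornerMajorant p := by
      rw [ae_all_iff]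
      intro L
      by_cases h : N ≤ L
      · filter_upwards [hN L h] with p hp _ using hp
      · exact Eventually.of_forall fun p h' => absurd h' h
    filter_upwards [hall, hlim] with p hp hl
    exact le_of_tendsto hl.norm (eventually_atTop.2 ⟨N, hp⟩)
  · refine (tendsto_integral_filter_of_dominated_convergence _ (Eventually.of_forall hmeas) hC
      hbound hlim).congr' ?_
    filter_upwards [hC, eventually_gt_atTop 0] with L hL hL0
    exact (sum_latticeRemainder_eq hL0 (hbound.mono' (hmeas L) hL)).symm

end limit

/-! ### The winding kernel and integration at fixed distance -/

/-- The cotangent without its poles at both ends of `(0, π)` is bounded. -/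
theorem abs_cot_sub_inv_add_inv_le {y : ℝ} (h0 : 0 < y) (hπ : y < π) :
    |cot y - 1 / y + 1 / (π - y)| ≤ 4 := by
  have hp := pi_gt_three
  have key : ∀ y, 0 < y → y ≤ π / 2 → |cot y - 1 / y + 1 / (π - y)| ≤ 4 := by
    intro y h0 h1
    have hy : 3 / 2 < π - y := by linarith
    have h2 := abs_cot_sub_inv_mul_le h0 (by linarith)
    have h3 : |cot y - 1 / y| ≤ 10 / 3 := by
      have := abs_nonneg (cot y - 1 / y)
      nlinarith
    have h4 : 1 / (π - y) ≤ 2 / 3 := by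
      rw [div_le_div_iff₀ (by linarith) (by norm_num)]; linarith
    have h5 : 0 < 1 / (π - y) := by positivity
    calc |cot y - 1 / y + 1 / (π - y)| ≤ |cot y - 1 / y| + |1 / (π - y)| := abs_add_le _ _
      _ ≤ 10 / 3 + 2 / 3 := by rw [abs_of_pos h5]; gcongr
      _ = 4 := by norm_num
  rcases le_total y (π / 2) with h | h
  · exact key y h0 h
  · have := key (π - y) (by linarith) (by linarith)
    rw [cot_eq_cos_div_sin, cos_pi_sub, sin_pi_sub, sub_sub_cancel, neg_div,
      ← cot_eq_cos_div_sin] at this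
    rw [← abs_neg]
    convert this using 2; ring

section kernel
variable {ν : ℝ → ℂ} {K : NNReal} {δ : ℝ}

theorem windingKernel_comm (ν : ℝ → ℂ) (δ q k : ℝ) :
    windingKernel ν δ q k = windingKernel ν δ k q := by
  have h1 : sin ((q - k) / 2) = -sin ((k - q) / 2) := by rw [← sin_neg]; congr 1; ring
  rw [windingKernel, windingKernel, h1]
  have h2 : ν q - ν k - (δ : ℂ) * ((q - k : ℝ) : ℂ) / (2 * (π : ℂ)) =
      -(ν k - ν q - (δ : ℂ) * ((k - q : ℝ) : ℂ) / (2 * (π : ℂ))) := by push_cast; ring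
  rw [h2, Complex.ofReal_neg, mul_neg, neg_div_neg_eq]

theorem windingKernel_self (ν : ℝ → ℂ) (δ q : ℝ) : windingKernel ν δ q q = 0 := by
  simp [windingKernel]

/-- The increments of `ν q - δ q / 2π`, which takes equal values at `-π` and `π`, are Lipschitz with
respect to the distance on the circle of length `2π`. -/
theorem norm_sub_sub_le (hν : LipschitzWith K ν) (hδ : 0 ≤ δ) (hwind : ν π - ν (-π) = δ)
    {q k : ℝ} (hq : q < π) (hk : -π < k) (hkq : k < q) :
    ‖ν q - ν k - (δ : ℂ) * ((q - k : ℝ) : ℂ) / (2 * (π : ℂ))‖ ≤ (K + δ / (2 * π)) * (q - k) ∧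
    ‖ν q - ν k - (δ : ℂ) * ((q - k : ℝ) : ℂ) / (2 * (π : ℂ))‖ ≤
      (K + δ / (2 * π)) * (2 * π - (q - k)) := by
  have hp := pi_pos
  have hπC : (π : ℂ) ≠ 0 := by exact_mod_cast pi_ne_zero
  constructor
  · have e : (δ : ℂ) * ((q - k : ℝ) : ℂ) / (2 * (π : ℂ)) = ((δ * (q - k) / (2 * π) : ℝ) : ℂ) := by
      push_cast; ring
    have h0 : 0 < q - k := by linarith
    rw [e]
    refine (norm_sub_le_of_le (hν.norm_sub_le q k) le_rfl).trans_eq ?_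
    rw [Complex.norm_real, norm_of_nonneg h0.le, norm_of_nonneg (by positivity)]
    ring
  · have e : ν q - ν k - (δ : ℂ) * ((q - k : ℝ) : ℂ) / (2 * (π : ℂ)) =
        (ν q - ν π) + (ν (-π) - ν k) + ((δ * (2 * π - (q - k)) / (2 * π) : ℝ) : ℂ) := by
      have : (δ : ℂ) = ν π - ν (-π) := hwind.symm
      push_cast
      field_simp
      rw [this]; ring
    rw [e]
    refine (norm_add_le_of_le (norm_add_le_of_le (hν.norm_sub_le q π)
      (hν.norm_sub_le (-π) k)) le_rfl).trans_eq ?_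
    have h1 : 0 < 2 * π - (q - k) := by linarith
    rw [Complex.norm_real, norm_of_nonpos (by linarith : q - π ≤ 0),
      norm_of_nonpos (by linarith : -π - k ≤ 0), norm_of_nonneg (by positivity)]
    ring

theorem norm_windingKernel_le (hν : LipschitzWith K ν) (hδ : 0 ≤ δ) (hwind : ν π - ν (-π) = δ)
    {q k : ℝ} (hq : q ∈ Set.Ioo (-π) π) (hk : k ∈ Set.Ioo (-π) π) :
    ‖windingKernel ν δ q k‖ ≤ (π / 2 * (K + δ / (2 * π))) ^ 2 := by
  have hp := pi_pos
  wlog hkq : k < q generalizing q k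
  · rcases (not_lt.1 hkq).eq_or_lt with h | h
    · rw [h, windingKernel_self, norm_zero]; positivity
    · rw [windingKernel_comm]; exact this hk hq h
  obtain ⟨h1, h2⟩ := norm_sub_sub_le hν hδ hwind hq.2 hk.1 hkq
  have ht : 0 < (q - k) / 2 := by linarith
  have htπ : (q - k) / 2 < π := by linarith [hq.2, hk.1]
  have hs := sin_pos_of_pos_of_lt_pi ht htπ
  have hi := inv_sin_le ht htπ
  rw [windingKernel, norm_pow, norm_div, norm_mul, Complex.norm_real, norm_of_nonneg hs.le]
  set N := ‖ν q - ν k - (δ : ℂ) * ((q - k : ℝ) : ℂ) / (2 * (π : ℂ))‖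
  have e4 : ‖(4 : ℂ)‖ = 4 := by norm_num
  rw [e4]
  have hN : 0 ≤ N := norm_nonneg _
  gcongr
  set M : ℝ := K + δ / (2 * π)
  have hqk : 0 < q - k := by linarith
  have hqk' : 0 < 2 * π - (q - k) := by linarith
  have e : 1 / (π - (q - k) / 2) = 2 / (2 * π - (q - k)) := by
    rw [div_eq_div_iff (by linarith) (by linarith)]; ring
  have a1 : N / (q - k) ≤ M := by rw [div_le_iff₀ hqk]; exact h1
  have a2 : N / (2 * π - (q - k)) ≤ M := by rw [div_le_iff₀ hqk']; exact h2
  calc N / (4 * sin ((q - k) / 2)) = N / 4 * (1 / sin ((q - k) / 2)) := by field_simp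
    _ ≤ N / 4 * (π / 2 * (1 / ((q - k) / 2) + 1 / (π - (q - k) / 2))) := by gcongr
    _ = π / 4 * (N / (q - k) + N / (2 * π - (q - k))) := by rw [e]; field_simp
    _ ≤ π / 4 * (M + M) := by gcongr
    _ = π / 2 * M := by ring

theorem measurable_windingKernel (hν : Continuous ν) :
    Measurable fun p : ℝ × ℝ => windingKernel ν δ p.1 p.2 := by
  have := hν.measurable
  unfold windingKernel
  fun_prop

theorem integrable_windingKernel (hν : LipschitzWith K ν) (hδ : 0 ≤ δ)
    (hwind : ν π - ν (-π) = δ) :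
    Integrable (fun p : ℝ × ℝ => windingKernel ν δ p.1 p.2) (zoneMeasure.prod zoneMeasure) := by
  refine Integrable.of_bound (measurable_windingKernel hν.continuous).aestronglyMeasurable
    ((π / 2 * (K + δ / (2 * π))) ^ 2) ?_
  filter_upwards [ae_mem_zone] with p hp using norm_windingKernel_le hν hδ hwind hp.1 hp.2

theorem zoneMeasure_prod_eq :
    zoneMeasure.prod zoneMeasure =
      (volume : Measure (ℝ × ℝ)).restrict (Set.Icc (-π) π ×ˢ Set.Icc (-π) π) := by
  rw [zoneMeasure, Measure.restrict_congr_set Ioc_ae_eq_Icc, Measure.prod_restrict,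
    Measure.volume_eq_prod]

/-- The winding kernel cut off to the triangle `k < q`. -/
noncomputable def lowerKernel (ν : ℝ → ℂ) (δ : ℝ) (p : ℝ × ℝ) : ℂ :=
  if p.2 < p.1 then windingKernel ν δ p.1 p.2 else 0

theorem integrable_lowerKernel (hν : LipschitzWith K ν) (hδ : 0 ≤ δ)
    (hwind : ν π - ν (-π) = δ) :
    Integrable (lowerKernel ν δ) (zoneMeasure.prod zoneMeasure) := by
  have hs : MeasurableSet {p : ℝ × ℝ | p.2 < p.1} := measurableSet_lt measurable_snd measurable_fst
  refine ((integrable_windingKernel hν hδ hwind).indicator hs).congr (Eventually.of_forall ?_)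
  intro p
  simp [Set.indicator, lowerKernel]

theorem integral_windingKernel_eq (hν : LipschitzWith K ν) (hδ : 0 ≤ δ)
    (hwind : ν π - ν (-π) = δ) :
    ∫ q in (-π)..π, ∫ k in (-π)..π, windingKernel ν δ q k =
      2 * ∫ p, lowerKernel ν δ p ∂(zoneMeasure.prod zoneMeasure) := by
  have hle : -π ≤ π := by linarith [pi_pos]
  have hl := integrable_lowerKernel hν hδ hwind
  rw [intervalIntegral.integral_of_le hle]
  simp_rw [intervalIntegral.integral_of_le hle]
  have h := integral_prod _ (integrable_windingKernel hν hδ hwind)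
  simp only [zoneMeasure] at h
  rw [← h]
  change ∫ p : ℝ × ℝ, windingKernel ν δ p.1 p.2 ∂(zoneMeasure.prod zoneMeasure) = _
  have e : ∀ p : ℝ × ℝ, windingKernel ν δ p.1 p.2 = lowerKernel ν δ p + lowerKernel ν δ p.swap := by
    intro p
    simp only [lowerKernel, Prod.fst_swap, Prod.snd_swap]
    rcases lt_trichotomy p.1 p.2 with h | h | h
    · rw [if_neg h.not_gt, if_pos h, zero_add, windingKernel_comm]
    · simp [h, windingKernel_self]
    · rw [if_neg h.not_gt, if_pos h, add_zero]
  have hl' : Integrable (fun p => lowerKernel ν δ p.swap) (zoneMeasure.prod zoneMeasure) := hl.swap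
  simp_rw [e]
  rw [integral_add hl hl', integral_prod_swap (fun p => lowerKernel ν δ p)]
  ring

/-- The difference of the density of the limit and of the kernel, as a function of the distance `t`
of the two momenta and of the increment `D` of `ν`; it is of degree one in `D`. -/
noncomputable def linearDensity (δ t : ℝ) (D : ℂ) : ℂ :=
  ((-(δ * t / (8 * π * sin (t / 2) ^ 2)) : ℝ) : ℂ) * D +
    ((δ ^ 2 * t ^ 2 / (32 * π ^ 2 * sin (t / 2) ^ 2) + δ ^ 2 / (2 * (2 * π - t) ^ 2) : ℝ) : ℂ)

theorem remainderDensity_eq (ν : ℝ → ℂ) (δ : ℝ) {p : ℝ × ℝ} (h1 : p.1 ∈ Set.Ioo (-π) π)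
    (h2 : p.2 ∈ Set.Ioo (-π) π) :
    remainderDensity ν δ p + 2 * lowerKernel ν δ p =
      if p.2 < p.1 then linearDensity δ (p.1 - p.2) (ν p.1 - ν p.2) else 0 := by
  rw [remainderDensity, lowerKernel]
  split_ifs with h
  · have hp := pi_pos
    have hπC : (π : ℂ) ≠ 0 := by exact_mod_cast pi_ne_zero
    have ht : 0 < (p.1 - p.2) / 2 := by linarith
    have htπ : (p.1 - p.2) / 2 < π := by linarith [h1.2, h2.1]
    have hs := (sin_pos_of_pos_of_lt_pi ht htπ).ne'
    have e1 : ((π - (p.1 - p.2) / 2 : ℝ) : ℂ) = ((2 * π - (p.1 - p.2) : ℝ) : ℂ) / 2 := by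
      push_cast; ring
    have e2 : Complex.sin ((π - (p.1 - p.2) / 2 : ℝ) : ℂ) = ((sin ((p.1 - p.2) / 2) : ℝ) : ℂ) := by
      rw [← Complex.ofReal_sin, sin_pi_sub]
    have hn : ((2 * π - (p.1 - p.2) : ℝ) : ℂ) ≠ 0 := by
      have : 2 * π - (p.1 - p.2) ≠ 0 := by linarith
      exact_mod_cast this
    have hsC : ((sin ((p.1 - p.2) / 2) : ℝ) : ℂ) ≠ 0 := by exact_mod_cast hs
    rw [e2, e1, windingKernel, linearDensity]
    generalize p.1 - p.2 = t at *
    generalize ν p.1 - ν p.2 = D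
    simp only [Complex.ofReal_add, Complex.ofReal_neg, Complex.ofReal_mul, Complex.ofReal_div,
      Complex.ofReal_pow, Complex.ofReal_ofNat]
    generalize ((sin (t / 2) : ℝ) : ℂ) = S at *
    generalize ((2 * π - t : ℝ) : ℂ) = E at *
    field_simp
    ring
  · simp

/-- The integral of the increments of `ν` at distance `t`, in terms of a primitive of `ν`. -/
noncomputable def incrementIntegral (ν : ℝ → ℂ) (t : ℝ) : ℂ :=
  (∫ k in (t - π)..π, ν k) - ∫ k in (-π)..(π - t), ν k

theorem integral_increment (hν : Continuous ν) (t : ℝ) :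
    ∫ k in (-π)..(π - t), (ν (t + k) - ν k) = incrementIntegral ν t := by
  rw [intervalIntegral.integral_sub ((by fun_prop : Continuous fun k => ν (t + k)).intervalIntegrable
    _ _) (hν.intervalIntegrable _ _), incrementIntegral, intervalIntegral.integral_comp_add_left]
  congr 2
  ring

/-- The density in the distance `t` of the two momenta obtained by integrating `linearDensity`. -/
noncomputable def distanceDensity (ν : ℝ → ℂ) (δ t : ℝ) : ℂ :=
  ((-(δ * t / (8 * π * sin (t / 2) ^ 2)) : ℝ) : ℂ) * incrementIntegral ν t +
    (((2 * π - t) * (δ ^ 2 * t ^ 2 / (32 * π ^ 2 * sin (t / 2) ^ 2) +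
      δ ^ 2 / (2 * (2 * π - t) ^ 2)) : ℝ) : ℂ)

theorem integral_linearDensity (hν : Continuous ν) (δ t : ℝ) :
    ∫ k in (-π)..(π - t), linearDensity δ t (ν (t + k) - ν k) = distanceDensity ν δ t := by
  simp only [linearDensity]
  rw [intervalIntegral.integral_add
    ((by fun_prop : Continuous fun k => ((-(δ * t / (8 * π * sin (t / 2) ^ 2)) : ℝ) : ℂ) *
      (ν (t + k) - ν k)).intervalIntegrable _ _) intervalIntegrable_const,
    intervalIntegral.integral_const_mul, integral_increment hν, intervalIntegral.integral_const,
    distanceDensity, Complex.real_smul]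
  push_cast
  ring

/-- Fubini in the coordinates `(q - k, k)`. -/
theorem integral_linearDensity_zone (hν : Continuous ν)
    (hint : Integrable (fun p : ℝ × ℝ => if p.2 < p.1 then
      linearDensity δ (p.1 - p.2) (ν p.1 - ν p.2) else 0) (zoneMeasure.prod zoneMeasure)) :
    IntervalIntegrable (distanceDensity ν δ) volume 0 (2 * π) ∧
    ∫ p : ℝ × ℝ, (if p.2 < p.1 then linearDensity δ (p.1 - p.2) (ν p.1 - ν p.2) else 0)
        ∂(zoneMeasure.prod zoneMeasure) =
      ∫ t in (0)..(2 * π), distanceDensity ν δ t := by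
  have hp := pi_pos
  set g : ℝ × ℝ → ℂ := fun p => if p.2 < p.1 then
      linearDensity δ (p.1 - p.2) (ν p.1 - ν p.2) else 0 with hg
  set Z : Set (ℝ × ℝ) := Set.Ioc (-π) π ×ˢ Set.Ioc (-π) π with hZ
  have hZm : MeasurableSet Z := measurableSet_Ioc.prod measurableSet_Ioc
  have hzone : zoneMeasure.prod zoneMeasure =
      ((volume : Measure ℝ).prod (volume : Measure ℝ)).restrict Z := by
    rw [zoneMeasure, Measure.prod_restrict]
  rw [hzone] at hint ⊢
  have hshear := measurePreserving_add_prod (volume : Measure ℝ) (volume : Measure ℝ)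
  have hind : Integrable (Z.indicator g) ((volume : Measure ℝ).prod (volume : Measure ℝ)) :=
    (integrable_indicator_iff hZm).2 hint
  have hcomp : Integrable (fun z : ℝ × ℝ => Z.indicator g (z.1 + z.2, z.2))
      ((volume : Measure ℝ).prod (volume : Measure ℝ)) :=
    (hshear.integrable_comp hind.aestronglyMeasurable).2 hind
  have hinner : ∀ t, ∫ k, Z.indicator g (t + k, k) =
      (Set.Ioc 0 (2 * π)).indicator (distanceDensity ν δ) t := by
    intro t
    by_cases ht : t ∈ Set.Ioc 0 (2 * π)
    · rw [Set.indicator_of_mem ht, ← integral_linearDensity hν,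
        intervalIntegral.integral_of_le (by linarith [ht.2]), ← integral_indicator measurableSet_Ioc]
      congr 1
      ext k
      by_cases hk : k ∈ Set.Ioc (-π) (π - t)
      · have : (t + k, k) ∈ Z := by
          simp only [hZ, Set.mem_prod, Set.mem_Ioc] at hk ⊢
          have := ht.1
          refine ⟨⟨?_, ?_⟩, ?_, ?_⟩ <;> linarith
        rw [Set.indicator_of_mem this, Set.indicator_of_mem hk]
        simp [hg, ht.1]
      · have : (t + k, k) ∉ Z := by
          simp only [hZ, Set.mem_prod, Set.mem_Ioc] at hk ⊢
          intro h
          exact hk ⟨h.2.1, by linarith [h.1.2]⟩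
        rw [Set.indicator_of_notMem this, Set.indicator_of_notMem hk]
    · rw [Set.indicator_of_notMem ht]
      refine integral_eq_zero_of_ae (Eventually.of_forall fun k => ?_)
      change Z.indicator g (t + k, k) = 0
      by_cases hk : (t + k, k) ∈ Z
      · rw [Set.indicator_of_mem hk]
        simp only [hZ, Set.mem_prod, Set.mem_Ioc] at hk
        have : ¬ k < t + k := fun h => ht ⟨by linarith, by linarith [hk.1.2, hk.2.1]⟩
        simp only [hg]
        rw [if_neg this]
      · exact Set.indicator_of_notMem hk _
  constructor
  · rw [intervalIntegrable_iff_integrableOn_Ioc_of_le (by linarith),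
      ← integrable_indicator_iff measurableSet_Ioc]
    have := hcomp.integral_prod_left
    simpa only [hinner] using this
  · rw [← integral_indicator hZm]
    have h1 : ∫ p, Z.indicator g p ∂((volume : Measure ℝ).prod (volume : Measure ℝ)) =
        ∫ z : ℝ × ℝ, Z.indicator g (z.1 + z.2, z.2)
          ∂((volume : Measure ℝ).prod (volume : Measure ℝ)) := by
      conv_lhs => rw [← hshear.map_eq]
      refine integral_map hshear.measurable.aemeasurable ?_
      rw [hshear.map_eq]
      exact hind.aestronglyMeasurable
    rw [h1, integral_prod _ hcomp]
    simp only [hinner]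
    rw [integral_indicator measurableSet_Ioc, intervalIntegral.integral_of_le (by linarith)]

theorem integral_remainderDensity (hν : LipschitzWith K ν) (hδ : 0 ≤ δ)
    (hwind : ν π - ν (-π) = δ) :
    IntervalIntegrable (distanceDensity ν δ) volume 0 (2 * π) ∧
    ∫ p, remainderDensity ν δ p ∂(zoneMeasure.prod zoneMeasure) =
      (∫ t in (0)..(2 * π), distanceDensity ν δ t) -
        ∫ q in (-π)..π, ∫ k in (-π)..π, windingKernel ν δ q k := by
  have h1 := (integrable_remainderDensity_and_tendsto hν hδ hwind).1
  have h2 := (integrable_lowerKernel hν hδ hwind).const_mul 2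
  have hae : (fun p => remainderDensity ν δ p + 2 * lowerKernel ν δ p)
      =ᵐ[zoneMeasure.prod zoneMeasure] fun p : ℝ × ℝ => if p.2 < p.1 then
      linearDensity δ (p.1 - p.2) (ν p.1 - ν p.2) else 0 := by
    filter_upwards [ae_mem_zone] with p hp using remainderDensity_eq ν δ hp.1 hp.2
  obtain ⟨h3, h4⟩ := integral_linearDensity_zone hν.continuous ((h1.add h2).congr hae)
  refine ⟨h3, ?_⟩
  rw [← h4, ← integral_congr_ae hae, integral_add h1 h2, integral_windingKernel_eq hν hδ hwind,
    integral_const_mul]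
  ring

/-- The poles of the integrand of `F(π)` at both ends cancel, so that it is bounded. -/
theorem intervalIntegrable_integrandLeft (hν : LipschitzWith K ν) :
    IntervalIntegrable (integrandLeft ν π) volume (-π) π := by
  have hp := pi_pos
  rw [intervalIntegrable_iff_integrableOn_Ioo_of_le (by linarith)]
  obtain ⟨B, hB⟩ := (isCompact_Icc (a := -π) (b := π)).exists_bound_of_continuousOn
    hν.continuous.continuousOn
  have hmeas : Measurable (integrandLeft ν π) := by
    have := hν.continuous.measurable
    have hc : Measurable cot := by
      have : cot = fun x => cos x / sin x := funext cot_eq_cos_div_sin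
      rw [this]; fun_prop
    unfold integrandLeft
    fun_prop
  refine Integrable.of_bound (C := K + 2 * B + K) hmeas.aestronglyMeasurable ?_
  filter_upwards [ae_restrict_mem measurableSet_Ioo] with q hq
  have hy0 : 0 < (π - q) / 2 := by linarith [hq.2]
  have hyπ : (π - q) / 2 < π := by linarith [hq.1]
  have hcot : cot ((q - π) / 2) = -cot ((π - q) / 2) := by
    have : (q - π) / 2 = -((π - q) / 2) := by ring
    rw [this, cot_eq_cos_div_sin, cos_neg, sin_neg, cot_eq_cos_div_sin, div_neg]
  have h1 : ((π - q : ℝ) : ℂ) ≠ 0 := by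
    have : π - q ≠ 0 := by linarith
    exact_mod_cast this
  have h2 : ((π + q : ℝ) : ℂ) ≠ 0 := by
    have : π + q ≠ 0 := by linarith [hq.1]
    exact_mod_cast this
  have e : integrandLeft ν π q = (ν q - ν π) / ((π - q : ℝ) : ℂ) +
      ν q / 2 * ((cot ((π - q) / 2) - 1 / ((π - q) / 2) + 1 / (π - (π - q) / 2) : ℝ) : ℂ) +
      (ν (-π) - ν q) / ((π + q : ℝ) : ℂ) := by
    have e1 : ((2 * π + q - π : ℝ) : ℂ) = ((π + q : ℝ) : ℂ) := by push_cast; ring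
    have e2 : ((q - π : ℝ) : ℂ) = -((π - q : ℝ) : ℂ) := by push_cast; ring
    have e3 : π - (π - q) / 2 = (π + q) / 2 := by ring
    rw [integrandLeft, hcot, e1, e2, e3]
    simp only [Complex.ofReal_add, Complex.ofReal_neg, Complex.ofReal_div, Complex.ofReal_ofNat,
      Complex.ofReal_one, Complex.ofReal_sub] at h1 h2 ⊢
    field_simp
    ring
  rw [e]
  refine norm_add_le_of_le (norm_add_le_of_le ?_ ?_) ?_
  · rw [norm_div, Complex.norm_real, norm_of_nonneg (by linarith : 0 ≤ π - q),
      div_le_iff₀ (by linarith)]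
    refine (hν.norm_sub_le q π).trans_eq ?_
    rw [norm_of_nonpos (by linarith : q - π ≤ 0)]; ring
  · have hb := hB q (Set.Ioo_subset_Icc_self hq)
    have hc := abs_cot_sub_inv_add_inv_le hy0 hyπ
    rw [norm_mul, norm_div, Complex.norm_real, norm_eq_abs]
    have e2 : ‖(2 : ℂ)‖ = 2 := by norm_num
    rw [e2]
    have hB0 : 0 ≤ B := (norm_nonneg _).trans hb
    calc ‖ν q‖ / 2 * |cot ((π - q) / 2) - 1 / ((π - q) / 2) + 1 / (π - (π - q) / 2)|
        ≤ B / 2 * 4 := by gcongr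
      _ = 2 * B := by ring
  · rw [norm_div, Complex.norm_real, norm_of_nonneg (by linarith [hq.1] : 0 ≤ π + q),
      div_le_iff₀ (by linarith [hq.1])]
    refine (hν.norm_sub_le (-π) q).trans_eq ?_
    rw [norm_of_nonpos (by linarith [hq.1] : -π - q ≤ 0)]; ring

end kernel

/-! ### Evaluation of the distance integral -/

theorem hasDerivAt_cot_half {t : ℝ} (hs : sin (t / 2) ≠ 0) :
    HasDerivAt (fun t => cot (t / 2)) (-(1 / (2 * sin (t / 2) ^ 2))) t := by
  have h2 : HasDerivAt (fun t : ℝ => t / 2) (1 / 2) t := (hasDerivAt_id t).div_const 2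
  have h := ((hasDerivAt_cos _).comp t h2).div ((hasDerivAt_sin _).comp t h2) hs
  have e : (fun t => cot (t / 2)) = (cos ∘ fun t => t / 2) / (sin ∘ fun t => t / 2) := by
    ext x; simp [cot_eq_cos_div_sin]
  rw [e]
  refine h.congr_deriv ?_
  simp only [Function.comp_apply]
  have := sin_sq_add_cos_sq (t / 2)
  field_simp
  linear_combination -this

theorem hasDerivAt_log_sin_half {t : ℝ} (hs : sin (t / 2) ≠ 0) :
    HasDerivAt (fun t => log (sin (t / 2))) (cot (t / 2) / 2) t := by
  have h2 : HasDerivAt (fun t : ℝ => t / 2) (1 / 2) t := (hasDerivAt_id t).div_const 2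
  have h := ((hasDerivAt_sin _).comp t h2).log hs
  refine h.congr_deriv ?_
  rw [cot_eq_cos_div_sin]; simp only [Function.comp_apply]; ring

theorem tendsto_sin_half_div :
    Tendsto (fun t : ℝ => sin (t / 2) / t) (𝓝[>] 0) (𝓝 (1 / 2)) := by
  have h2 : HasDerivAt (fun t : ℝ => t / 2) (1 / 2) 0 := (hasDerivAt_id 0).div_const 2
  have h := (((hasDerivAt_sin _).comp 0 h2).tendsto_slope_zero_right)
  simp only [Function.comp_apply, zero_add, zero_div, sin_zero, cos_zero, sub_zero, smul_eq_mul,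
    one_mul] at h
  exact h.congr fun t => by ring

theorem tendsto_mul_cot_half :
    Tendsto (fun t : ℝ => t * cot (t / 2)) (𝓝[>] 0) (𝓝 2) := by
  have h1 : Tendsto (fun t : ℝ => cos (t / 2)) (𝓝[>] 0) (𝓝 1) := by
    have : Continuous fun t : ℝ => cos (t / 2) := by fun_prop
    have := (this.tendsto 0).mono_left (nhdsWithin_le_nhds (s := Set.Ioi 0))
    simpa using this
  have h := h1.div tendsto_sin_half_div (by norm_num)
  have e : (1 : ℝ) / (1 / 2) = 2 := by norm_num
  rw [e] at h
  refine h.congr fun t => ?_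
  simp only [Pi.div_apply]
  rw [cot_eq_cos_div_sin, div_div_eq_mul_div]; ring

/-- The coefficient of `δ²` in `distancePrimitive`, which does not depend on `ν`. -/
noncomputable def cornerPrimitive (t : ℝ) : ℝ :=
  -(1 / (16 * π)) * (cot (t / 2) * (t * (2 * π - t))) +
    1 / (4 * π) * ((π - t) * log (sin (t / 2))) - 1 / 4 * log t + 1 / 4 * log (2 * π - t)

theorem tendsto_cornerPrimitive_zero :
    Tendsto cornerPrimitive (𝓝[>] 0) (𝓝 (-(1 / 4) + 1 / 4 * log π)) := by
  have hp := pi_pos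
  have hid : Tendsto (fun t : ℝ => t) (𝓝[>] 0) (𝓝 0) := nhdsWithin_le_nhds
  have h2π : Tendsto (fun t : ℝ => 2 * π - t) (𝓝[>] 0) (𝓝 (2 * π - 0)) := hid.const_sub _
  have hlog : Tendsto (fun t : ℝ => t * log t) (𝓝[>] 0) (𝓝 0) := by
    have := (continuous_mul_log.tendsto 0).mono_left (nhdsWithin_le_nhds (s := Set.Ioi 0))
    simpa using this
  have h1 := ((tendsto_mul_cot_half.mul h2π).const_mul (-(1 / (16 * π))))
  have hs := tendsto_sin_half_div.log (by norm_num)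
  have h2 := (hs.const_mul (1 / 4))
  have h3 := (((hid.mul hs).add hlog).const_mul (1 / (4 * π)))
  have h4 := (h2π.log (by rw [sub_zero]; positivity)).const_mul (1 / 4)
  have h := ((h1.add h2).sub h3).add h4
  have e : -(1 / (16 * π)) * (2 * (2 * π - 0)) + 1 / 4 * log (1 / 2) -
      1 / (4 * π) * (0 * log (1 / 2) + 0) + 1 / 4 * log (2 * π - 0) = -(1 / 4) + 1 / 4 * log π := by
    have hl : log (1 / 2) = -log 2 := by rw [one_div, log_inv]
    rw [sub_zero, log_mul (by norm_num) hp.ne', hl]; field_simp; ring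
  rw [e] at h
  refine h.congr' ?_
  filter_upwards [Ioo_mem_nhdsGT (by positivity : 0 < π)] with t ht
  have hst : 0 < sin (t / 2) := sin_pos_of_pos_of_lt_pi (by linarith [ht.1]) (by linarith [ht.2])
  rw [cornerPrimitive, log_div hst.ne' ht.1.ne']
  field_simp
  ring

theorem cornerPrimitive_reflect (t : ℝ) : cornerPrimitive (2 * π - t) = -cornerPrimitive t := by
  have e : (2 * π - t) / 2 = π - t / 2 := by ring
  rw [cornerPrimitive, cornerPrimitive, e, cot_eq_cos_div_sin, cos_pi_sub, sin_pi_sub,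
    sub_sub_cancel, cot_eq_cos_div_sin]
  ring

theorem hasDerivAt_cornerPrimitive {t : ℝ} (h0 : 0 < t) (h1 : t < 2 * π) :
    HasDerivAt cornerPrimitive (t * (2 * π - t) / (32 * π * sin (t / 2) ^ 2) -
      log (sin (t / 2)) / (4 * π) - π / (2 * (t * (2 * π - t)))) t := by
  have hp := pi_pos
  have hs : sin (t / 2) ≠ 0 := (sin_pos_of_pos_of_lt_pi (by linarith) (by linarith)).ne'
  have hi : HasDerivAt (fun t : ℝ => t) 1 t := hasDerivAt_id t
  have h2π : HasDerivAt (fun t : ℝ => 2 * π - t) (-1) t := hi.const_sub _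
  have hn : 2 * π - t ≠ 0 := by linarith
  have ha := ((hasDerivAt_cot_half hs).mul (hi.mul h2π)).const_mul (-(1 / (16 * π)))
  have hb := ((hi.const_sub π).mul (hasDerivAt_log_sin_half hs)).const_mul (1 / (4 * π))
  have hc := (hi.log h0.ne').const_mul (1 / 4)
  have hd := (h2π.log hn).const_mul (1 / 4)
  have h := ((ha.add hb).sub hc).add hd
  refine h.congr_deriv ?_
  simp only [Pi.mul_apply]
  have key : 1 / 4 * (1 / t + 1 / (2 * π - t)) = π / (2 * (t * (2 * π - t))) := by
    rw [div_add_div _ _ h0.ne' hn, ← mul_div_assoc,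
      div_eq_div_iff (by simp [h0.ne', hn]) (by simp [h0.ne', hn])]
    ring
  linear_combination -key

section identity
variable {ν : ℝ → ℂ} {K : NNReal} {δ : ℝ}

theorem hasDerivAt_incrementIntegral (hν : Continuous ν) (t : ℝ) :
    HasDerivAt (incrementIntegral ν) (ν (π - t) - ν (t - π)) t := by
  have h1 : HasDerivAt (fun t : ℝ => t - π) 1 t := (hasDerivAt_id t).sub_const π
  have h2 : HasDerivAt (fun t : ℝ => π - t) (-1) t := (hasDerivAt_id t).const_sub π
  have hl : HasDerivAt (fun u => ∫ k in u..π, ν k) (-ν (t - π)) (t - π) :=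
    intervalIntegral.integral_hasDerivAt_left (hν.intervalIntegrable _ _)
      (hν.stronglyMeasurableAtFilter _ _) hν.continuousAt
  have hr : HasDerivAt (fun u => ∫ k in (-π)..u, ν k) (ν (π - t)) (π - t) :=
    intervalIntegral.integral_hasDerivAt_right (hν.intervalIntegrable _ _)
      (hν.stronglyMeasurableAtFilter _ _) hν.continuousAt
  have h := (hl.scomp t h1).sub (hr.scomp t h2)
  refine h.congr_deriv ?_
  simp; ring

theorem incrementIntegral_zero (ν : ℝ → ℂ) : incrementIntegral ν 0 = 0 := by
  simp [incrementIntegral]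

theorem incrementIntegral_reflect (hν : Continuous ν) (t : ℝ) :
    incrementIntegral ν (2 * π - t) = incrementIntegral ν t := by
  have hI : ∀ a b, IntervalIntegrable ν volume a b := fun a b => hν.intervalIntegrable a b
  rw [incrementIntegral, incrementIntegral]
  have e1 : 2 * π - t - π = π - t := by ring
  have e2 : π - (2 * π - t) = t - π := by ring
  rw [e1, e2]
  have h1 := intervalIntegral.integral_add_adjacent_intervals (hI (-π) (π - t)) (hI (π - t) π)
  have h2 := intervalIntegral.integral_add_adjacent_intervals (hI (-π) (t - π)) (hI (t - π) π)
  linear_combination h1 - h2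

/-- A primitive, up to a multiple of `log (sin (t / 2))`, of the symmetrized distance density
corrected by the integrand of `δ F(π)`. -/
noncomputable def distancePrimitive (ν : ℝ → ℂ) (δ t : ℝ) : ℂ :=
  δ / 4 * (((cot (t / 2) : ℝ) : ℂ) * incrementIntegral ν t) + δ ^ 2 * (cornerPrimitive t : ℂ)

theorem distancePrimitive_reflect (hν : Continuous ν) (t : ℝ) :
    distancePrimitive ν δ (2 * π - t) = -distancePrimitive ν δ t := by
  have e : (2 * π - t) / 2 = π - t / 2 := by ring
  rw [distancePrimitive, distancePrimitive, incrementIntegral_reflect hν, cornerPrimitive_reflect,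
    e, cot_eq_cos_div_sin, cos_pi_sub, sin_pi_sub, cot_eq_cos_div_sin]
  push_cast; ring

theorem tendsto_distancePrimitive_zero (hν : Continuous ν) (hwind : ν π - ν (-π) = δ) :
    Tendsto (distancePrimitive ν δ) (𝓝[>] 0)
      (𝓝 (((δ ^ 2 * (1 / 4 + 1 / 4 * log π) : ℝ) : ℂ))) := by
  have hD := (hasDerivAt_incrementIntegral hν 0).tendsto_slope_zero_right
  simp only [zero_add, incrementIntegral_zero, sub_zero, zero_sub, hwind, Complex.real_smul] at hD
  have hc := tendsto_mul_cot_half.ofReal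
  have h := (((hc.mul hD).const_mul (δ / 4 : ℂ)).add
    ((tendsto_cornerPrimitive_zero.ofReal).const_mul ((δ : ℂ) ^ 2)))
  have e : (δ / 4 * (((2 : ℝ) : ℂ) * δ) + δ ^ 2 * ((-(1 / 4) + 1 / 4 * log π : ℝ) : ℂ) : ℂ) =
      ((δ ^ 2 * (1 / 4 + 1 / 4 * log π) : ℝ) : ℂ) := by push_cast; ring
  rw [e] at h
  refine h.congr' ?_
  filter_upwards [self_mem_nhdsWithin] with t ht
  have : (t : ℂ) ≠ 0 := by exact_mod_cast (ne_of_gt ht)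
  rw [distancePrimitive]
  push_cast
  field_simp

theorem tendsto_distancePrimitive_two_pi (hν : Continuous ν) (hwind : ν π - ν (-π) = δ) :
    Tendsto (distancePrimitive ν δ) (𝓝[<] (2 * π))
      (𝓝 (-((δ ^ 2 * (1 / 4 + 1 / 4 * log π) : ℝ) : ℂ))) := by
  have hr : Tendsto (fun t : ℝ => 2 * π - t) (𝓝[<] (2 * π)) (𝓝[>] 0) := by
    refine tendsto_nhdsWithin_iff.2 ⟨?_, ?_⟩
    · have : Continuous fun t : ℝ => 2 * π - t := by fun_prop
      have := (this.tendsto (2 * π)).mono_left (nhdsWithin_le_nhds (s := Set.Iio (2 * π)))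
      simpa using this
    · filter_upwards [self_mem_nhdsWithin] with t ht
      simpa using ht
  refine ((tendsto_distancePrimitive_zero hν hwind).comp hr).neg.congr fun t => ?_
  simp only [Function.comp_apply]
  rw [distancePrimitive_reflect hν, neg_neg]

theorem hasDerivAt_distancePrimitive (hν : Continuous ν) (hwind : ν π - ν (-π) = δ) {t : ℝ}
    (h0 : 0 < t) (h1 : t < 2 * π) :
    HasDerivAt (distancePrimitive ν δ)
      (1 / 2 * (distanceDensity ν δ t + distanceDensity ν δ (2 * π - t)) +
        δ / 2 * (integrandLeft ν π (π - t) + integrandLeft ν π (t - π)) -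
        ((δ ^ 2 / (4 * π) * log (sin (t / 2)) : ℝ) : ℂ)) t := by
  have hp := pi_pos
  have hs : sin (t / 2) ≠ 0 := (sin_pos_of_pos_of_lt_pi (by linarith) (by linarith)).ne'
  have ha := (((hasDerivAt_cot_half hs).ofReal_comp.mul
    (hasDerivAt_incrementIntegral hν t)).const_mul (δ / 4 : ℂ))
  have hb := (hasDerivAt_cornerPrimitive h0 h1).ofReal_comp.const_mul ((δ : ℂ) ^ 2)
  have h := ha.add hb
  refine h.congr_deriv ?_
  have e1 : sin ((2 * π - t) / 2) = sin (t / 2) := by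
    have : (2 * π - t) / 2 = π - t / 2 := by ring
    rw [this, sin_pi_sub]
  have e2 : cot ((π - t - π) / 2) = -cot (t / 2) := by
    have : (π - t - π) / 2 = -(t / 2) := by ring
    rw [this, cot_eq_cos_div_sin, cos_neg, sin_neg, cot_eq_cos_div_sin, div_neg]
  have e3 : cot ((t - π - π) / 2) = cot (t / 2) := by
    have : (t - π - π) / 2 = t / 2 - π := by ring
    rw [this, cot_eq_cos_div_sin, cos_sub_pi, sin_sub_pi, cot_eq_cos_div_sin, neg_div_neg_eq]
  have e4 : ν π = ν (-π) + δ := by rw [← hwind]; ring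
  rw [distanceDensity, distanceDensity, incrementIntegral_reflect hν, integrandLeft, integrandLeft,
    e1, e2, e3, e4]
  have hπC : (π : ℂ) ≠ 0 := by exact_mod_cast pi_ne_zero
  have hsC : ((sin (t / 2) : ℝ) : ℂ) ≠ 0 := by exact_mod_cast hs
  have ht : (t : ℂ) ≠ 0 := by exact_mod_cast h0.ne'
  have hn : (2 * π - t : ℂ) ≠ 0 := by
    have : 2 * π - t ≠ 0 := by linarith
    exact_mod_cast this
  have f1 : ((2 * π + (π - t) - π : ℝ) : ℂ) = 2 * π - t := by push_cast; ring
  have f2 : ((π - t - π : ℝ) : ℂ) = -t := by push_cast; ring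
  have f3 : ((2 * π + (t - π) - π : ℝ) : ℂ) = t := by push_cast; ring
  have f4 : ((t - π - π : ℝ) : ℂ) = -(2 * π - t) := by push_cast; ring
  have f5 : ((2 * π - (2 * π - t) : ℝ) : ℂ) = t := by push_cast; ring
  rw [f1, f2, f3, f4]
  have f6 : 2 * π - (2 * π - t) = t := by ring
  rw [f6]
  simp only [Complex.ofReal_add, Complex.ofReal_neg, Complex.ofReal_mul, Complex.ofReal_div,
      Complex.ofReal_pow, Complex.ofReal_ofNat, Complex.ofReal_sub, Complex.ofReal_one]
  generalize ((sin (t / 2) : ℝ) : ℂ) = S at *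
  generalize ((cot (t / 2) : ℝ) : ℂ) = c at *
  generalize ((log (sin (t / 2)) : ℝ) : ℂ) = l at *
  generalize hE : (2 * π - t : ℂ) = E at *
  have ht' : (t : ℂ) = 2 * π - E := by rw [← hE]; ring
  have hEt : (2 * π : ℂ) = E + t := by rw [← hE]; ring
  -- In the two variables `t` and `E = 2π - t` the identity is one of rational functions.
  have hπE : (π : ℂ) = (E + t) / 2 := by rw [← hEt]; ring
  have hEt0 : E + t ≠ 0 := by rw [← hEt]; exact mul_ne_zero two_ne_zero hπC
  simp only [hπE]
  field_simp
  ring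

theorem integral_log_sin_half :
    ∫ t in (0)..(2 * π), log (sin (t / 2)) = -(2 * π * log 2) := by
  rw [intervalIntegral.integral_comp_div (fun x => log (sin x)) two_ne_zero]
  have : 2 * π / 2 = π := by ring
  rw [zero_div, this, integral_log_sin_zero_pi, smul_eq_mul]; ring

theorem intervalIntegrable_log_sin_half :
    IntervalIntegrable (fun t => log (sin (t / 2))) volume 0 (2 * π) := by
  have h := (intervalIntegrable_log_sin (a := 0) (b := π)).comp_mul_left (c := 1 / 2)
  convert h using 1
  · ext t; simp only [Function.comp_apply]; congr 2; ring
  · norm_num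
  · ring

/-- The integral of the distance density is the phase `-δ F(π)` up to an explicit constant. -/
theorem integral_distanceDensity (hν : LipschitzWith K ν) (hwind : ν π - ν (-π) = δ)
    (hint : IntervalIntegrable (distanceDensity ν δ) volume 0 (2 * π)) :
    ∫ t in (0)..(2 * π), distanceDensity ν δ t =
      -(δ * phaseF ν π) - ((δ ^ 2 / 2 + δ ^ 2 / 2 * log (2 * π) : ℝ) : ℂ) := by
  have hp := pi_pos
  have hF := intervalIntegrable_integrandLeft hν
  have hphase : phaseF ν π = ∫ q in (-π)..π, integrandLeft ν π q := by
    rw [phaseF, intervalIntegral.integral_same, zero_add]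
  have hint2 : IntervalIntegrable (fun t => distanceDensity ν δ (2 * π - t)) volume 0 (2 * π) := by
    have := (hint.comp_sub_left (2 * π)).symm
    simpa using this
  have hF1 : IntervalIntegrable (fun t => integrandLeft ν π (π - t)) volume 0 (2 * π) := by
    have := (hF.comp_sub_left π).symm
    convert this using 1 <;> ring
  have hF2 : IntervalIntegrable (fun t => integrandLeft ν π (t - π)) volume 0 (2 * π) := by
    have := hF.comp_sub_right π
    convert this using 1 <;> ring
  have hlog : IntervalIntegrable (fun t => ((δ ^ 2 / (4 * π) * log (sin (t / 2)) : ℝ) : ℂ)) volume 0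
      (2 * π) := by
    have h := intervalIntegrable_log_sin_half.const_mul (δ ^ 2 / (4 * π))
    exact ⟨h.1.ofReal, h.2.ofReal⟩
  have hA := (hint.add hint2).const_mul (1 / 2 : ℂ)
  have hB := (hF1.add hF2).const_mul (δ / 2 : ℂ)
  -- The integral is unchanged under `t ↦ 2π - t`; averaging over it makes the integrand exact.
  have ftc := intervalIntegral.integral_eq_sub_of_hasDerivAt_of_tendsto (by positivity : 0 < 2 * π)
    (fun t ht => hasDerivAt_distancePrimitive hν.continuous hwind ht.1 ht.2)
    ((hA.add hB).sub hlog)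
    (tendsto_distancePrimitive_zero hν.continuous hwind)
    (tendsto_distancePrimitive_two_pi hν.continuous hwind)
  rw [intervalIntegral.integral_sub (hA.add hB) hlog, intervalIntegral.integral_add hA hB,
    intervalIntegral.integral_const_mul, intervalIntegral.integral_const_mul,
    intervalIntegral.integral_add hint hint2, intervalIntegral.integral_add hF1 hF2,
    intervalIntegral.integral_comp_sub_left (fun t => distanceDensity ν δ t),
    intervalIntegral.integral_comp_sub_left (fun t => integrandLeft ν π t),
    intervalIntegral.integral_comp_sub_right (fun t => integrandLeft ν π t),
    intervalIntegral.integral_ofReal, intervalIntegral.integral_const_mul,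
    integral_log_sin_half] at ftc
  have e1 : 2 * π - 2 * π = 0 := by ring
  have e2 : π - 2 * π = -π := by ring
  have e3 : 2 * π - π = π := by ring
  rw [e1, sub_zero, e2, sub_zero, zero_sub, e3, ← hphase] at ftc
  have e4 : δ ^ 2 / (4 * π) * -(2 * π * log 2) = -(δ ^ 2 / 2 * log 2) := by field_simp; ring
  rw [e4] at ftc
  rw [log_mul two_ne_zero hp.ne']
  push_cast at ftc ⊢
  linear_combination ftc

end identity

/-! ### The asymptotics for Lipschitz functions -/

theorem prefactor_ne_zero (ν : ℝ → ℂ) {δ : ℝ} (hδ : 0 ≤ δ) : prefactor ν δ ≠ 0 := by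
  have h1 := (barnesG_one_add_pos hδ).ne'
  have h2 : (2 * π) ^ (-(δ * (δ + 1) / 2)) ≠ 0 := (rpow_pos_of_pos (by positivity) _).ne'
  rw [prefactor]
  exact mul_ne_zero (mul_ne_zero (by exact_mod_cast h1) (by exact_mod_cast h2))
    (Complex.exp_ne_zero _)

section main
variable {ν : ℝ → ℂ} {K : NNReal} {δ : ℝ}

/-- The Barnes factor of the corner product and the limit of the second order remainders combine to
the prefactor: the terms `δ² / 2` cancel and the powers of `2π` add up to `-δ (δ + 1) / 2`. -/
theorem tendsto_doubleProduct_mul_rpow (hν : LipschitzWith K ν) (hδ : 0 ≤ δ)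
    (hwind : ν π - ν (-π) = δ) :
    Tendsto (fun L : ℕ => doubleProduct ν L * (((L : ℝ) ^ (δ ^ 2 / 2) : ℝ) : ℂ)) atTop
      (𝓝 (prefactor ν δ)) := by
  obtain ⟨C, -, hC⟩ := exists_norm_latticeRemainder_le hν hδ hwind
  have hsum := ((integrable_remainderDensity_and_tendsto hν hδ hwind).2).cexp
  have hprod := (tendsto_prod_mul_rpow hδ).ofReal
  have h := hprod.mul hsum
  have hval : ((barnesG (1 + δ) * exp (-(δ / 2) * log (2 * π) + δ / 2 + δ ^ 2 / 2) : ℝ) : ℂ) *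
      Complex.exp (∫ p, remainderDensity ν δ p ∂(zoneMeasure.prod zoneMeasure)) =
      prefactor ν δ := by
    obtain ⟨hint, hval⟩ := integral_remainderDensity hν hδ hwind
    rw [hval, integral_distanceDensity hν hwind hint, prefactor, rpow_def_of_pos (by positivity)]
    simp only [Complex.ofReal_mul, Complex.ofReal_exp]
    rw [mul_assoc, mul_assoc, ← Complex.exp_add, ← Complex.exp_add]
    congr 2
    push_cast
    ring
  rw [hval] at h
  refine h.congr' ?_
  filter_upwards [hC] with L hL
  rw [doubleProduct_eq hδ L fun i j hji hiL => (hL i j hji hiL).1]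
  push_cast
  ring

theorem isEquivalent_doubleProduct (hν : LipschitzWith K ν) (hδ : 0 ≤ δ)
    (hwind : ν π - ν (-π) = δ) :
    Asymptotics.IsEquivalent atTop (fun L : ℕ => doubleProduct ν L)
      (fun L : ℕ => prefactor ν δ / (((L : ℝ) ^ (δ ^ 2 / 2) : ℝ) : ℂ)) := by
  have hpow : ∀ᶠ L : ℕ in atTop, (((L : ℝ) ^ (δ ^ 2 / 2) : ℝ) : ℂ) ≠ 0 := by
    filter_upwards [eventually_gt_atTop 0] with L hL
    have : (L : ℝ) ^ (δ ^ 2 / 2) ≠ 0 := (rpow_pos_of_pos (by exact_mod_cast hL) _).ne'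
    exact_mod_cast this
  have hA := prefactor_ne_zero ν hδ
  refine (Asymptotics.isEquivalent_iff_tendsto_one ?_).2 ?_
  · filter_upwards [hpow] with L hL using div_ne_zero hA hL
  · have h := (tendsto_doubleProduct_mul_rpow hν hδ hwind).div_const (prefactor ν δ)
    rw [div_self hA] at h
    refine h.congr' ?_
    filter_upwards [hpow] with L hL
    simp only [Pi.div_apply]
    field_simp

end main

/-! ### Reduction to Lipschitz functions on the line -/

section congr
variable {ν μ : ℝ → ℂ}

theorem momentum_mem_Icc {L i : ℕ} (h1 : 1 ≤ i) (h2 : i ≤ L) :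
    momentum L i ∈ Set.Icc (-π) π := by
  have hp := pi_pos
  obtain ⟨i, rfl⟩ := Nat.exists_eq_add_of_le' h1
  have hL : (0 : ℝ) < L := by exact_mod_cast (by omega : 0 < L)
  have hi : (i : ℝ) + 1 ≤ L := by exact_mod_cast h2
  rw [momentum_succ (by omega)]
  have : 0 ≤ 2 * π / L * ((i : ℝ) + 1 / 2) := by positivity
  have h3 : 2 * π / L * ((i : ℝ) + 1 / 2) ≤ 2 * π / L * L := by gcongr; linarith
  have h4 : 2 * π / L * L = 2 * π := by field_simp
  constructor <;> linarith

theorem doubleProduct_congr (h : Set.EqOn ν μ (Set.Icc (-π) π)) (L : ℕ) :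
    doubleProduct ν L = doubleProduct μ L := by
  refine Finset.prod_congr rfl fun i hi => Finset.prod_congr rfl fun j hj => ?_
  rw [Finset.mem_Icc] at hi
  rw [Finset.mem_Ico] at hj
  rw [h (momentum_mem_Icc hi.1 hi.2), h (momentum_mem_Icc hj.1 (by omega))]

theorem integrandLeft_congr (h : Set.EqOn ν μ (Set.Icc (-π) π)) :
    Set.EqOn (integrandLeft ν π) (integrandLeft μ π) (Set.Icc (-π) π) := by
  intro q hq
  have hp := pi_pos
  rw [integrandLeft, integrandLeft, h hq, h (Set.left_mem_Icc.2 (by linarith)),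
    h (Set.right_mem_Icc.2 (by linarith))]

theorem windingKernel_congr (h : Set.EqOn ν μ (Set.Icc (-π) π)) (δ : ℝ) {q k : ℝ}
    (hq : q ∈ Set.Icc (-π) π) (hk : k ∈ Set.Icc (-π) π) :
    windingKernel ν δ q k = windingKernel μ δ q k := by
  rw [windingKernel, windingKernel, h hq, h hk]

theorem prefactor_congr (h : Set.EqOn ν μ (Set.Icc (-π) π)) (δ : ℝ) :
    prefactor ν δ = prefactor μ δ := by
  have hu : Set.uIcc (-π) π = Set.Icc (-π) π := Set.uIcc_of_le (by linarith [pi_pos])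
  have h1 : phaseF ν π = phaseF μ π := by
    simp only [phaseF, intervalIntegral.integral_same, zero_add]
    exact intervalIntegral.integral_congr (by rw [hu]; exact integrandLeft_congr h)
  have h2 : ∫ q in (-π)..π, ∫ k in (-π)..π, windingKernel ν δ q k =
      ∫ q in (-π)..π, ∫ k in (-π)..π, windingKernel μ δ q k := by
    refine intervalIntegral.integral_congr fun q hq => intervalIntegral.integral_congr fun k hk => ?_
    rw [hu] at hq hk
    exact windingKernel_congr h δ hq hk
  rw [prefactor, prefactor, h1, h2]

/-- A smooth function on the Brillouin zone coincides there with a Lipschitz function on the line,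
constant outside the zone. -/
theorem exists_lipschitzWith_eqOn (hν : ContDiffOn ℝ ∞ ν (Set.Icc (-π) π)) :
    ∃ (K : NNReal) (μ : ℝ → ℂ), LipschitzWith K μ ∧ Set.EqOn ν μ (Set.Icc (-π) π) := by
  have hle : -π ≤ π := by linarith [pi_pos]
  obtain ⟨K, hK⟩ := (hν.of_le (by simp : (1 : WithTop ℕ∞) ≤ ∞)).exists_lipschitzOnWith
    (by simp) (convex_Icc (-π) π) isCompact_Icc
  refine ⟨K * 1, Set.IccExtend hle (Set.domRestrict (Set.Icc (-π) π) ν),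
    (lipschitzOnWith_iff_restrict.1 hK).comp (LipschitzWith.projIcc hle), fun q hq => ?_⟩
  rw [Set.IccExtend_of_mem hle _ hq, Set.domRestrict_apply]

end congr

/-! ### The asymptotics for smooth functions -/

theorem lemma4 (ν : ℝ → ℂ) (hν : ContDiffOn ℝ ∞ ν (Set.Icc (-Real.pi) Real.pi))
    (δ : ℝ) (hδ : 0 ≤ δ) (hwind : ν Real.pi - ν (-Real.pi) = (δ : ℂ)) :
    IntervalIntegrable (integrandLeft ν Real.pi) MeasureTheory.volume (-Real.pi) Real.pi ∧
    MeasureTheory.IntegrableOn (fun p : ℝ × ℝ => windingKernel ν δ p.1 p.2)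
      (Set.Icc (-Real.pi) Real.pi ×ˢ Set.Icc (-Real.pi) Real.pi) MeasureTheory.volume ∧
    prefactor ν δ ≠ 0 ∧
    Asymptotics.IsEquivalent Filter.atTop
      (fun L : ℕ => doubleProduct ν L)
      (fun L : ℕ => prefactor ν δ / (((L : ℝ) ^ (δ ^ 2 / 2) : ℝ) : ℂ)) := by
  have hle : -π ≤ π := by linarith [pi_pos]
  obtain ⟨K, μ, hμ, hνμ⟩ := exists_lipschitzWith_eqOn hν
  have hwind' : μ π - μ (-π) = δ := by
    rw [← hνμ (Set.right_mem_Icc.2 hle), ← hνμ (Set.left_mem_Icc.2 hle), hwind]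
  refine ⟨?_, ?_, prefactor_ne_zero ν hδ, ?_⟩
  · rw [intervalIntegrable_iff_integrableOn_Icc_of_le hle]
    have h := intervalIntegrable_integrandLeft hμ
    rw [intervalIntegrable_iff_integrableOn_Icc_of_le hle] at h
    exact (integrableOn_congr_fun (integrandLeft_congr hνμ) measurableSet_Icc).2 h
  · have h := integrable_windingKernel hμ hδ hwind'
    rw [zoneMeasure_prod_eq] at h
    refine (integrableOn_congr_fun (fun p hp => ?_) (measurableSet_Icc.prod measurableSet_Icc)).2 h
    exact windingKernel_congr hνμ δ hp.1 hp.2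
  · simp only [doubleProduct_congr hνμ, prefactor_congr hνμ]
    exact isEquivalent_doubleProduct hμ hδ hwind'
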